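/- Let $\alpha\ge 1$ and let $\phi_\alpha$ satisfy $\phi_\alpha'(r)=-r^{-\alpha}$ for $r>0$. Consider $k$ bodies of mass $1$ in $E=\mathbb R^2$; write $J$ for the rotation by $\pi/2$, $U(u)=\sum_{i<j}\phi_\alpha(\|u_i-u_j\|)$, $V(u)=\frac12\sum_j\|u_j\|^2+U(u)$ and $E_{\rm red}=\{u\in E^k:\sum_j u_j=0\}$. A central configuration is a collision-free $a\in E_{\rm red}$ with $\nabla V(a)=0$. For an integer $p\neq0$ it is called $2\pi p$-nondegenerate if its orbit under rotations is a nondegenerate critical manifold of $$A(u)=\int_0^{2\pi}\Big(\tfrac12\sum_{j}\big\|\tfrac1p\,\dot u_j(s)+Ju_j(s)\big\|^2+U(u(s))\Big)ds$$ on $H^1(S^1,E_{\rm red})$, $S^1=\mathbb R/2\pi\mathbb Z$, i.e. if the constant loop $a$ is a critical point of $A$ and the kernel in $H^1(S^1,E_{\rm red})$ of the Hessian (second variation) of $A$ at $a$ is the real line spanned by the constant loop $Ja=(Ja_1,\dots,Ja_k)$. The $k$-polygon is $$a=s_1^{1/(\alpha+1)}\big(e^{J\zeta}e_1,\dots,e^{kJ\zeta}e_1\big),\qquad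 \zeta=\tfrac{2\pi}k,\quad e_1=(1,0),\quad s_1=\frac1{2^{\alpha}}\sum_{l=1}^{k-1}\frac1{\sin^{\alpha-1}(l\zeta/2)} .$$ For $\alpha\in(1,3)$ put $\mathcal C_{k,\alpha}=\{p\in\mathbb N: p\notin (k-1)\mathbb N\cup(3-\alpha)^{-1/2}\mathbb N\}$. **Theorem.** Let $k$ be such that $k-1$ is prime. 1. For every $p\in\mathbb N$ there is $\delta>0$ (depending on $k$ and $p$) such that for every $\alpha\in(1,1+\delta)$ with $p\in\mathcal C_{k,\alpha}$ the $k$-polygon is a $2\pi p$-nondegenerate central configuration. 2. There is $\delta>0$ (depending on $k$) such that for every $\alpha\in(1,1+\delta)$ the set $\mathcal C_{k,\alpha}$ is infinite, and the $k$-polygon is a $2\pi p$-nondegenerate central configuration for infinitely many $p\in\mathcal C_{k,\alpha}$. -/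

import Mathlib

open Real Set MeasureTheory

noncomputable section

namespace Carousel

/-! The Euclidean plane `E = ℝ²` is `ℂ`, its complex structure `J` is multiplication by
`Complex.I`, and a configuration of `k` bodies is an element of `Fin k → ℂ`. -/

/-- The pair potential `φ_α`, normalised so that `φ_α'(r) = -r ^ (-α)` for `r > 0`. -/
def phi (α r : ℝ) : ℝ :=
  if α = 1 then -Real.log r else r ^ (1 - α) / (α - 1)

/-- The potential function `U(u) = ∑_{i < j} m_i m_j φ_α(‖u_i - u_j‖)`. -/
def potential {k : ℕ} (α : ℝ) (m : Fin k → ℝ) (u : Fin k → ℂ) : ℝ :=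
  ∑ i, ∑ j ∈ Finset.Ioi i, m i * m j * phi α ‖u i - u j‖

/-- The amended potential `V(u) = ½ ∑_j m_j ‖u_j‖² + U(u)`. -/
def amendedPotential {k : ℕ} (α : ℝ) (m : Fin k → ℝ) (u : Fin k → ℂ) : ℝ :=
  1 / 2 * ∑ j, m j * ‖u j‖ ^ 2 + potential α m u

/-- A central configuration (of frequency one and with zero centre of mass): a collision-free
critical point of the amended potential whose centre of mass is the origin. -/
structure IsCentralConfiguration {k : ℕ} (α : ℝ) (m : Fin k → ℝ) (a : Fin k → ℂ) : Prop where
  collisionFree : Function.Injective a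
  centered : ∑ j, (m j : ℂ) * a j = 0
  critical : HasFDerivAt (𝕜 := ℝ) (amendedPotential α m) 0 a

/-- The Sobolev space `H¹(S¹, E_red)`, `S¹ = ℝ / 2πℤ`, where `E_red` is the space of
configurations with zero centre of mass. In dimension one, `H¹` consists of the absolutely
continuous loops with square integrable derivative. -/
def loopSpace {k : ℕ} (m : Fin k → ℝ) : Set (ℝ → Fin k → ℂ) :=
  {u | Function.Periodic u (2 * π) ∧
    AbsolutelyContinuousOnInterval u 0 (2 * π) ∧
    MemLp (deriv u) 2 (volume.restrict (Ioc 0 (2 * π))) ∧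
    ∀ s, ∑ j, (m j : ℂ) * u s j = 0}

/-- The regularized action
`A(u) = ∫₀^{2π} (½ ∑_j m_j ‖((1/p) ∂_s + J) u_j(s)‖² + U(u(s))) ds`. -/
def action {k : ℕ} (α : ℝ) (m : Fin k → ℝ) (p : ℤ) (u : ℝ → Fin k → ℂ) : ℝ :=
  ∫ s in (0 : ℝ)..(2 * π),
    (1 / 2 * ∑ j, m j * ‖((1 / p : ℝ) : ℂ) * deriv u s j + Complex.I * u s j‖ ^ 2
      + potential α m (u s))

/-- The Hessian (second variation) of a functional `F` at `a`, as a bilinear form: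
`∂_x ∂_y F(a + x u + y v)` at `x = y = 0`. -/
def hessian {X : Type*} [AddCommGroup X] [Module ℝ X] (F : X → ℝ) (a u v : X) : ℝ :=
  deriv (fun x : ℝ => deriv (fun y : ℝ => F (a + x • u + y • v)) 0) 0

/-- The central configuration `a` is `2πp`-nondegenerate: its `U(1)`-orbit is a nondegenerate
critical manifold of the regularized action on `H¹(S¹, E_red)`, that is, the constant loop `a` is
a critical point and the kernel of the Hessian there is the line spanned by `J a`. -/
structure IsNondegenerate {k : ℕ} (α : ℝ) (m : Fin k → ℝ) (p : ℤ) (a : Fin k → ℂ) : Prop where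
  central : IsCentralConfiguration α m a
  critical : ∀ v ∈ loopSpace m,
    HasDerivAt (fun y : ℝ => action α m p ((fun _ => a) + y • v)) 0 0
  hessian_ker :
    {u | u ∈ loopSpace m ∧ ∀ v ∈ loopSpace m, hessian (action α m p) (fun _ => a) u v = 0} =
      (Submodule.span ℝ {(fun _ => Complex.I • a : ℝ → Fin k → ℂ)} : Set (ℝ → Fin k → ℂ))

/-- `s₁ = 2^{-α} ∑_{l=1}^{k-1} sin(π l / k) ^ (-(α - 1))`. -/
def sOne (k : ℕ) (α : ℝ) : ℝ :=
  1 / 2 ^ α * ∑ l ∈ Finset.Ico 1 k, 1 / Real.sin (l * (2 * π / k) / 2) ^ (α - 1)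

/-- The regular `k`-gon of circumradius `s₁ ^ (1 / (α + 1))`, with vertices at the angles
`2πj/k`, `j = 1, …, k`. -/
def polygon (k : ℕ) (α : ℝ) : Fin k → ℂ := fun j =>
  ((sOne k α ^ (1 / (α + 1)) : ℝ) : ℂ) *
    Complex.exp (Complex.I * (((j : ℕ) + 1 : ℕ) * (2 * π / k)))

/-- For unit masses, the regular `k`-gon is a `2πp`-nondegenerate central configuration. -/
def PolygonNondegenerate (k : ℕ) (α : ℝ) (p : ℕ) : Prop :=
  IsNondegenerate α (fun _ : Fin k => (1 : ℝ)) (p : ℤ) (polygon k α)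

/-- `C_{k,α} = {p ∈ ℕ : p ∉ (k-1)ℕ ∪ (3-α)^{-1/2}ℕ}`; since `0` is a multiple of everything,
its elements are positive. -/
def admissible (k : ℕ) (α : ℝ) : Set ℕ :=
  {p | ¬ (∃ n : ℕ, p = (k - 1) * n) ∧ ¬ ∃ n : ℕ, (p : ℝ) = (3 - α) ^ (-(1 / 2) : ℝ) * n}

end Carousel

end

noncomputable section

namespace Carousel

open scoped InnerProductSpace ComplexConjugate

/-! ### Absolutely continuous functions with values in a vector space -/

/-! The second variation at the `k`-gon is diagonalised by a double Fourier transform: a discrete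
one over the bodies, in the frame rotating with the vertices (index `m`, class `vertex j ^ (m +
1)`), and the usual one in time (frequency `n`, with `ν = n / p`). The Hessian of `U` is a
complex-linear plus a conjugate-linear circulant operator, so the mode `(m, n)` is coupled only to
the conjugate of `(-m, -n)`. The kernel is thus governed by 2×2 determinants `modeDet k α r m ν`
(`mode_hessianOp`, `hessian_testLoop`, `loopCoeff_eq_zero_of_modeDet`).

The class `m = -1` is the centre of mass and vanishes. Its partner `m = 1` satisfies a scalar
equation with positive coefficient. For `m = 0` the determinant is `ν² (ν² - (3 - α))`: the zero at
`ν = 0` is the rotation direction `J a`, and the other zeros are what excluding `(3 - α)^(-1/2) ℕ`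
removes.

For `2 ≤ m ≤ k - 2` the determinant is studied near the logarithmic case `α = 1`. There the symbol
is `S = m (k - m) / (k - 1)` (`symbol_log`) and the determinant factors as `(ν² - S)(ν² - 2 + S)`.
With `q = k - 1` prime and `q ∤ m (k - m)`, a rational zero `n / p` would equate an odd and an even
`q`-adic valuation (`sq_mul_ne_sq_mul_of_not_dvd`). For fixed `p`, large `|n|` gives a positive
determinant uniformly in `α` (`modeDet_pos`), while the finitely many remaining `n` are handled by
continuity in `α`. This proves the first claim.

For the second claim, the case `p = 1` yields a `δ` for which no integer `ν` is a zero. With `α`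
fixed, the zeros form a finite set `B` without integers. If `N` is a common denominator of its
rational elements, then no fraction with denominator `p = 1 + (k - 1) N t` lies in `B`
(`exists_avoiding_progression`), and these `p` are infinitely many. -/

theorem absolutelyContinuousOnInterval_clm_comp {E F : Type*} [NormedAddCommGroup E]
    [NormedSpace ℝ E] [NormedAddCommGroup F] [NormedSpace ℝ F] (L : E →L[ℝ] F) {f : ℝ → E}
    {a b : ℝ} (hf : AbsolutelyContinuousOnInterval f a b) :
    AbsolutelyContinuousOnInterval (fun s => L (f s)) a b := by
  unfold AbsolutelyContinuousOnInterval at hf ⊢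
  refine squeeze_zero (fun _ => Finset.sum_nonneg fun _ _ => dist_nonneg) (fun E => ?_)
    (by simpa using hf.const_mul ‖L‖)
  rw [Finset.mul_sum]
  exact Finset.sum_le_sum fun i _ => L.lipschitz.dist_le_mul _ _

/-- Reduces to the real fundamental theorem through real and imaginary parts: a real functional
commutes with the derivative almost everywhere, since `f` has bounded variation. -/
theorem integral_deriv_eq_sub_complex {f : ℝ → ℂ} {a b : ℝ}
    (hf : AbsolutelyContinuousOnInterval f a b) (hi : IntervalIntegrable (deriv f) volume a b) :
    ∫ s in a..b, deriv f s = f b - f a := by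
  have hae := hf.boundedVariationOn.ae_differentiableAt_of_mem_uIcc
  have key : ∀ L : ℂ →L[ℝ] ℝ, L (∫ s in a..b, deriv f s) = L (f b - f a) := by
    intro L
    rw [← L.intervalIntegral_comp_comm hi, map_sub,
      ← (absolutelyContinuousOnInterval_clm_comp L hf).integral_deriv_eq_sub]
    refine intervalIntegral.integral_congr_ae ?_
    filter_upwards [hae] with s hs hs'
    exact ((L.hasFDerivAt.comp_hasDerivAt s (hs (uIoc_subset_uIcc hs')).hasDerivAt).deriv).symm
  exact Complex.ext (key Complex.reCLM) (key Complex.imCLM)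

theorem hasDerivAt_cexp_int (n : ℤ) (s : ℝ) :
    HasDerivAt (fun s : ℝ => Complex.exp (Complex.I * n * s))
      (Complex.I * n * Complex.exp (Complex.I * n * s)) s := by
  have h := ((hasDerivAt_id (s : ℂ)).const_mul (Complex.I * n)).cexp.comp_ofReal
  simpa [mul_comm] using h

theorem contDiff_cexp_int (n : ℤ) :
    ContDiff ℝ 1 (fun s : ℝ => Complex.exp (Complex.I * n * s)) :=
  ((contDiff_const.mul Complex.ofRealCLM.contDiff)).cexp

theorem cexp_int_two_pi (n : ℤ) : Complex.exp (Complex.I * n * ((2 * π : ℝ) : ℂ)) = 1 := by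
  rw [Complex.exp_eq_one_iff]
  exact ⟨n, by push_cast; ring⟩

/-- Integration by parts; the boundary terms cancel by periodicity. -/
theorem integral_cexp_mul_deriv {f : ℝ → ℂ} (n : ℤ)
    (hf : AbsolutelyContinuousOnInterval f 0 (2 * π))
    (hi : IntervalIntegrable (deriv f) volume 0 (2 * π)) (hp : f (2 * π) = f 0) :
    ∫ s in (0 : ℝ)..(2 * π), Complex.exp (Complex.I * n * s) * deriv f s =
      -(Complex.I * n) * ∫ s in (0 : ℝ)..(2 * π), Complex.exp (Complex.I * n * s) * f s := by
  have hE : AbsolutelyContinuousOnInterval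
      (fun s : ℝ => Complex.exp (Complex.I * n * s)) 0 (2 * π) :=
    (contDiff_cexp_int n).contDiffOn.absolutelyContinuousOnInterval
  have hEc : Continuous fun s : ℝ => Complex.exp (Complex.I * n * s) :=
    (contDiff_cexp_int n).continuous
  have hprod : AbsolutelyContinuousOnInterval
      (fun s : ℝ => Complex.exp (Complex.I * n * s) * f s) 0 (2 * π) := hE.fun_smul hf
  have hae := hf.boundedVariationOn.ae_differentiableAt_of_mem_uIcc
  have hder : ∀ᵐ s : ℝ, s ∈ uIoc 0 (2 * π) →
      deriv (fun s : ℝ => Complex.exp (Complex.I * n * s) * f s) s =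
        Complex.exp (Complex.I * n * s) * deriv f s +
          (Complex.I * n) * (Complex.exp (Complex.I * n * s) * f s) := by
    filter_upwards [hae] with s hs hs'
    refine (HasDerivAt.deriv ((hasDerivAt_cexp_int n s).mul
      (hs (uIoc_subset_uIcc hs')).hasDerivAt)).trans ?_
    ring
  have h1 : IntervalIntegrable (fun s : ℝ => Complex.exp (Complex.I * n * s) * deriv f s)
      volume 0 (2 * π) := hi.continuousOn_mul hEc.continuousOn
  have h2 : IntervalIntegrable (fun s : ℝ => (Complex.I * n) *
      (Complex.exp (Complex.I * n * s) * f s)) volume 0 (2 * π) :=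
    (hprod.continuousOn.intervalIntegrable).const_mul _
  have hint : IntervalIntegrable
      (deriv (fun s : ℝ => Complex.exp (Complex.I * n * s) * f s)) volume 0 (2 * π) := by
    refine (h1.add h2).congr_ae ?_
    refine (ae_restrict_iff' measurableSet_uIoc).2 ?_
    filter_upwards [hder] with s hs hs'
    exact (hs hs').symm
  have h := integral_deriv_eq_sub_complex hprod hint
  rw [intervalIntegral.integral_congr_ae hder, intervalIntegral.integral_add h1 h2,
    intervalIntegral.integral_const_mul, cexp_int_two_pi, hp] at h
  simp only [Complex.ofReal_zero, mul_zero, Complex.exp_zero, sub_self] at h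
  linear_combination h

/-! ### Uniqueness of Fourier coefficients -/

theorem eq_zero_of_fourier_integral_eq_zero {f : ℝ → ℂ} (hf : ContinuousOn f (Icc 0 (2 * π)))
    (hp : Function.Periodic f (2 * π))
    (h : ∀ n : ℤ, ∫ s in (0 : ℝ)..(2 * π), Complex.exp (Complex.I * n * s) * f s = 0) (s : ℝ) :
    f s = 0 := by
  have : Fact (0 < 2 * π) := ⟨two_pi_pos⟩
  have hf0 : f 0 = f (0 + 2 * π) := (hp 0).symm
  have hc : Continuous (AddCircle.liftIco (2 * π) 0 f) :=
    AddCircle.liftIco_continuous hf0 (by simpa using hf)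
  set F : C(AddCircle (2 * π), ℂ) := ⟨_, hc⟩ with hF
  have hcoe : ∀ n, fourierCoeff F n = 0 := by
    intro n
    change fourierCoeff (AddCircle.liftIco (2 * π) 0 f) n = 0
    rw [fourierCoeff_liftIco_eq, fourierCoeffOn_eq_integral]
    have : ∫ x in (0 : ℝ)..(0 + 2 * π),
        (fourier (-n) (x : AddCircle (0 + 2 * π - 0)) : ℂ) • f x = 0 := by
      rw [zero_add, ← h (-n)]
      refine intervalIntegral.integral_congr fun x _ => ?_
      simp only [fourier_coe_apply, smul_eq_mul]
      congr 2
      have : (π : ℂ) ≠ 0 := by exact_mod_cast pi_ne_zero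
      push_cast
      field_simp
      ring
    rw [this, smul_zero]
  -- Vanishing coefficients are trivially summable, so the Fourier series converges pointwise to the
  -- continuous function, which is therefore zero.
  have hsum : Summable (fourierCoeff F) := by
    rw [funext hcoe]; exact summable_zero
  have hzero : ∀ x : AddCircle (2 * π), F x = 0 := by
    intro x
    have := has_pointwise_sum_fourier_series_of_summable hsum x
    simp only [hcoe, zero_smul] at this
    exact this.unique hasSum_zero
  obtain ⟨y, hy, hy'⟩ := hp.exists_mem_Ico₀ two_pi_pos s
  rw [hy', ← AddCircle.liftIco_coe_apply (p := 2 * π) (a := 0) (f := f) (by simpa using hy)]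
  exact hzero y

/-! ### Differentiation under the integral sign -/

theorem hasDerivAt_integral_of_continuousOn {F F' : ℝ → ℝ → ℝ} {ε b : ℝ} (hε : 0 < ε)
    (hb : 0 ≤ b)
    (hF : ∀ x ∈ Icc (-ε) ε, ContinuousOn (F x) (Icc 0 b))
    (hF' : ContinuousOn (Function.uncurry F') (Icc (-ε) ε ×ˢ Icc 0 b))
    (h : ∀ x ∈ Icc (-ε) ε, ∀ s ∈ Icc 0 b, HasDerivAt (fun x => F x s) (F' x s) x) :
    HasDerivAt (fun x => ∫ s in (0 : ℝ)..b, F x s) (∫ s in (0 : ℝ)..b, F' 0 s) 0 := by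
  have hmem : Icc (-ε) ε ∈ nhds (0 : ℝ) := Icc_mem_nhds (by linarith) hε
  obtain ⟨C, hC⟩ := (isCompact_Icc.prod isCompact_Icc).exists_bound_of_continuousOn hF'
  have h0 : (0 : ℝ) ∈ Icc (-ε) ε := ⟨by linarith, hε.le⟩
  have hsub : uIoc 0 b ⊆ Icc 0 b := by rw [uIoc_of_le hb]; exact Ioc_subset_Icc_self
  have hF'0 : ContinuousOn (F' 0) (Icc 0 b) :=
    hF'.comp (f := fun s : ℝ => ((0 : ℝ), s)) (by fun_prop) fun s hs => ⟨h0, hs⟩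
  refine (intervalIntegral.hasDerivAt_integral_of_dominated_loc_of_deriv_le
    (bound := fun _ => C) hmem ?_ ?_ ?_ ?_ ?_ ?_).2
  · filter_upwards [hmem] with x hx
    exact ((hF x hx).mono hsub).aestronglyMeasurable measurableSet_uIoc
  · exact ContinuousOn.intervalIntegrable (by rw [uIcc_of_le hb]; exact hF 0 h0)
  · exact (hF'0.mono hsub).aestronglyMeasurable measurableSet_uIoc
  · exact Filter.Eventually.of_forall fun s hs x hx => hC (x, s) ⟨hx, hsub hs⟩
  · exact intervalIntegrable_const
  · exact Filter.Eventually.of_forall fun s hs x hx => h x hx s (hsub hs)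

/-! ### The loop space -/

theorem periodic_two_pi_eq {X : Type*} {u : ℝ → X} (h : Function.Periodic u (2 * π)) :
    u (2 * π) = u 0 := by
  simpa using h 0

section LoopSpace

variable {k : ℕ} {m : Fin k → ℝ} {u v : ℝ → Fin k → ℂ}

theorem absolutelyContinuous_apply (hu : u ∈ loopSpace m) (j : Fin k) :
    AbsolutelyContinuousOnInterval (fun s => u s j) 0 (2 * π) :=
  absolutelyContinuousOnInterval_clm_comp
    (ContinuousLinearMap.proj (R := ℝ) (φ := fun _ : Fin k => ℂ) j) hu.2.1

theorem continuousOn_of_mem_loopSpace (hu : u ∈ loopSpace m) (j : Fin k) :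
    ContinuousOn (fun s => u s j) (Icc 0 (2 * π)) := by
  have := (absolutelyContinuous_apply hu j).continuousOn
  rwa [uIcc_of_le two_pi_pos.le] at this

theorem ae_differentiableAt_of_mem_loopSpace (hu : u ∈ loopSpace m) :
    ∀ᵐ s : ℝ, s ∈ uIoc 0 (2 * π) → DifferentiableAt ℝ u s := by
  filter_upwards [hu.2.1.boundedVariationOn.ae_differentiableAt_of_mem_uIcc] with s hs hs'
  exact hs (uIoc_subset_uIcc hs')

theorem deriv_apply_of_differentiableAt {s : ℝ} (h : DifferentiableAt ℝ u s) (j : Fin k) :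
    deriv (fun s => u s j) s = deriv u s j :=
  (hasDerivAt_pi.1 h.hasDerivAt j).deriv

theorem memLp_deriv_apply (hu : u ∈ loopSpace m) (j : Fin k) :
    MemLp (fun s => deriv u s j) 2 (volume.restrict (Ioc 0 (2 * π))) :=
  (ContinuousLinearMap.proj (R := ℝ) (φ := fun _ : Fin k => ℂ) j).comp_memLp' hu.2.2.1

theorem intervalIntegrable_deriv_apply (hu : u ∈ loopSpace m) (j : Fin k) :
    IntervalIntegrable (fun s => deriv u s j) volume 0 (2 * π) := by
  rw [intervalIntegrable_iff_integrableOn_Ioc_of_le two_pi_pos.le]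
  exact (memLp_deriv_apply hu j).integrable (by norm_num)

theorem integral_cexp_mul_deriv_apply (hu : u ∈ loopSpace m) (n : ℤ) (j : Fin k) :
    ∫ s in (0 : ℝ)..(2 * π), Complex.exp (Complex.I * n * s) * deriv u s j =
      -(Complex.I * n) * ∫ s in (0 : ℝ)..(2 * π), Complex.exp (Complex.I * n * s) * u s j := by
  have hae : ∀ᵐ s : ℝ, s ∈ uIoc 0 (2 * π) → deriv (fun s => u s j) s = deriv u s j := by
    filter_upwards [ae_differentiableAt_of_mem_loopSpace hu] with s hs hs'
    exact deriv_apply_of_differentiableAt (hs hs') j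
  rw [← integral_cexp_mul_deriv n (absolutelyContinuous_apply hu j) _
    (by simp only [periodic_two_pi_eq hu.1])]
  · refine intervalIntegral.integral_congr_ae ?_
    filter_upwards [hae] with s hs hs'
    rw [hs hs']
  · refine (intervalIntegrable_deriv_apply hu j).congr_ae ?_
    refine (ae_restrict_iff' measurableSet_uIoc).2 ?_
    filter_upwards [hae] with s hs hs'
    exact (hs hs').symm

theorem integral_deriv_apply_eq_zero (hu : u ∈ loopSpace m) (j : Fin k) :
    ∫ s in (0 : ℝ)..(2 * π), deriv u s j = 0 := by
  simpa using integral_cexp_mul_deriv_apply hu 0 j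

theorem mem_loopSpace_of_contDiff (hu : ContDiff ℝ 1 u) (hp : Function.Periodic u (2 * π))
    (hc : ∀ s, ∑ j, (m j : ℂ) * u s j = 0) : u ∈ loopSpace m := by
  refine ⟨hp, hu.contDiffOn.absolutelyContinuousOnInterval, ?_, hc⟩
  have hd : Continuous (deriv u) := hu.continuous_deriv le_rfl
  obtain ⟨C, hC⟩ := (isCompact_Icc (a := (0 : ℝ)) (b := 2 * π)).exists_bound_of_continuousOn
    hd.continuousOn
  refine MemLp.of_bound hd.aestronglyMeasurable C ?_
  refine (ae_restrict_iff' measurableSet_Ioc).2 (Filter.Eventually.of_forall fun s hs => ?_)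
  exact hC s (Ioc_subset_Icc_self hs)

theorem const_mem_loopSpace {a : Fin k → ℂ} (ha : ∑ j, (m j : ℂ) * a j = 0) :
    (fun _ => a) ∈ loopSpace m :=
  mem_loopSpace_of_contDiff contDiff_const (fun _ => rfl) fun _ => ha

/-- The covariant velocity `((1/p) ∂_s + J) u`. -/
def velocity (p : ℤ) (u : ℝ → Fin k → ℂ) (s : ℝ) (j : Fin k) : ℂ :=
  ((1 / p : ℝ) : ℂ) * deriv u s j + Complex.I * u s j

theorem memLp_velocity (hu : u ∈ loopSpace m) (p : ℤ) (j : Fin k) :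
    MemLp (fun s => velocity p u s j) 2 (volume.restrict (Ioc 0 (2 * π))) := by
  refine ((memLp_deriv_apply hu j).const_mul _).add (MemLp.const_mul ?_ _)
  have hc := continuousOn_of_mem_loopSpace hu j
  obtain ⟨C, hC⟩ := isCompact_Icc.exists_bound_of_continuousOn hc
  refine MemLp.of_bound ((hc.mono Ioc_subset_Icc_self).aestronglyMeasurable measurableSet_Ioc)
    C ?_
  refine (ae_restrict_iff' measurableSet_Ioc).2 (Filter.Eventually.of_forall fun s hs => ?_)
  exact hC s (Ioc_subset_Icc_self hs)

/-- Holds only where both loops are differentiable, hence almost everywhere; this suffices inside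
the action integral. -/
theorem velocity_const_add (a : Fin k → ℂ) (p : ℤ) (x y : ℝ) {s : ℝ}
    (hu : DifferentiableAt ℝ u s) (hv : DifferentiableAt ℝ v s) (j : Fin k) :
    velocity p ((fun _ => a) + x • u + y • v) s j =
      Complex.I * a j + x • velocity p u s j + y • velocity p v s j := by
  have h : deriv ((fun _ => a) + x • u + y • v) s = x • deriv u s + y • deriv v s := by
    have := (((hasDerivAt_const s a).add (hu.hasDerivAt.const_smul x)).add
      (hv.hasDerivAt.const_smul y)).deriv
    simpa using this
  simp only [velocity, h, Pi.add_apply, Pi.smul_apply, Complex.real_smul]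
  ring

end LoopSpace

/-! ### Derivatives of the pair potential -/

/-- The power is written as `(‖·‖²)^(q/2)`, so that only the smooth squared norm is differentiated.
-/
theorem hasDerivAt_norm_rpow (q : ℝ) (z v : ℂ) (y : ℝ) (h : z + y • v ≠ 0) :
    HasDerivAt (fun y : ℝ => ‖z + y • v‖ ^ q)
      (q * ‖z + y • v‖ ^ (q - 2) * ⟪z + y • v, v⟫_ℝ) y := by
  have h0 : HasDerivAt (fun y : ℝ => z + y • v) v y := by
    simpa using ((hasDerivAt_id y).smul_const v).const_add z
  have h1 := (h0.norm_sq).rpow_const (p := q / 2)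
    (Or.inl (by have := norm_pos_iff.2 h; positivity))
  have hpow : ∀ (w : ℂ) (r : ℝ), (‖w‖ ^ 2) ^ (r / 2) = ‖w‖ ^ r := by
    intro w r
    rw [← Real.rpow_natCast, ← Real.rpow_mul (norm_nonneg _)]
    congr 1; push_cast; ring
  rw [show q / 2 - 1 = (q - 2) / 2 by ring] at h1
  simp only [hpow] at h1
  convert h1 using 1
  ring

theorem hasDerivAt_phi_norm {α : ℝ} (hα : 1 < α) (z v : ℂ) (y : ℝ) (h : z + y • v ≠ 0) :
    HasDerivAt (fun y : ℝ => phi α ‖z + y • v‖)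
      (-(‖z + y • v‖ ^ (-(α + 1)) * ⟪z + y • v, v⟫_ℝ)) y := by
  have h1 := (hasDerivAt_norm_rpow (1 - α) z v y h).div_const (α - 1)
  simp only [phi, hα.ne', if_false]
  refine h1.congr_deriv ?_
  rw [show 1 - α - 2 = -(α + 1) by ring]
  have : α - 1 ≠ 0 := by linarith
  field_simp
  ring

/-- The Hessian of `z ↦ φ_α(‖z‖)` on `ℂ`. -/
def pairHessian (α : ℝ) (z u v : ℂ) : ℝ :=
  (α + 1) * ‖z‖ ^ (-(α + 3)) * ⟪z, u⟫_ℝ * ⟪z, v⟫_ℝ - ‖z‖ ^ (-(α + 1)) * ⟪u, v⟫_ℝ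

theorem hasDerivAt_pairForce (α : ℝ) (z u v : ℂ) (x : ℝ) (h : z + x • u ≠ 0) :
    HasDerivAt (fun x : ℝ => -(‖z + x • u‖ ^ (-(α + 1)) * ⟪z + x • u, v⟫_ℝ))
      (pairHessian α (z + x • u) u v) x := by
  have h0 : HasDerivAt (fun y : ℝ => z + y • u) u x := by
    simpa using ((hasDerivAt_id x).smul_const u).const_add z
  have h1 := ((hasDerivAt_norm_rpow (-(α + 1)) z u x h).mul
    (h0.inner ℝ (hasDerivAt_const x v))).neg
  refine h1.congr_deriv ?_
  rw [show -(α + 1) - 2 = -(α + 3) by ring]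
  simp only [pairHessian, inner_zero_right, zero_add]
  ring

/-- Keeps perturbed separations away from collision. `C + 1` instead of `C` keeps the later divisors
positive even when `C = 0`. -/
theorem add_smul_ne_zero {z w : ℂ} {x C : ℝ} (hw : ‖w‖ ≤ C)
    (hx : |x| * (C + 1) < ‖z‖) : z + x • w ≠ 0 := by
  intro h
  have h1 : ‖z‖ = |x| * ‖w‖ := by
    rw [eq_neg_of_add_eq_zero_left h, norm_neg, norm_smul, Real.norm_eq_abs]
  have : |x| * ‖w‖ ≤ |x| * (C + 1) := by gcongr; linarith
  linarith

section PairIntegrals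

variable {α b : ℝ} {z : ℂ} {u v : ℝ → ℂ}

theorem hasDerivAt_integral_pairForce (hz : z ≠ 0) (hb : 0 ≤ b)
    (hu : ContinuousOn u (Icc 0 b)) (hv : ContinuousOn v (Icc 0 b)) :
    HasDerivAt (fun x : ℝ => ∫ s in (0 : ℝ)..b,
        -(‖z + x • u s‖ ^ (-(α + 1)) * ⟪z + x • u s, v s⟫_ℝ))
      (∫ s in (0 : ℝ)..b, pairHessian α z (u s) (v s)) 0 := by
  obtain ⟨C, hC⟩ := isCompact_Icc.exists_bound_of_continuousOn hu
  have hC0 : 0 ≤ C := (norm_nonneg _).trans (hC 0 ⟨le_rfl, hb⟩)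
  have hzp := norm_pos_iff.2 hz
  set ε := ‖z‖ / (2 * (C + 1)) with hε
  have hεp : 0 < ε := by positivity
  have hne : ∀ x ∈ Icc (-ε) ε, ∀ s ∈ Icc 0 b, z + x • u s ≠ 0 := by
    intro x hx s hs
    refine add_smul_ne_zero (hC s hs) ?_
    calc |x| * (C + 1) ≤ ε * (C + 1) := by gcongr; exact abs_le.2 hx
      _ = ‖z‖ / 2 := by rw [hε]; field_simp
      _ < ‖z‖ := by linarith
  have := hasDerivAt_integral_of_continuousOn (b := b)
    (F := fun x s => -(‖z + x • u s‖ ^ (-(α + 1)) * ⟪z + x • u s, v s⟫_ℝ))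
    (F' := fun x s => pairHessian α (z + x • u s) (u s) (v s)) hεp hb ?_ ?_ ?_
  · simpa using this
  · intro x hx
    have h1 : ContinuousOn (fun s => z + x • u s) (Icc 0 b) := by fun_prop
    exact ((h1.norm.rpow_const fun s hs => Or.inl (norm_ne_zero_iff.2 (hne x hx s hs))).mul
      (h1.inner hv)).neg
  · have hu' : ContinuousOn (fun q : ℝ × ℝ => u q.2) (Icc (-ε) ε ×ˢ Icc 0 b) :=
      hu.comp continuousOn_snd fun q hq => hq.2
    have hv' : ContinuousOn (fun q : ℝ × ℝ => v q.2) (Icc (-ε) ε ×ˢ Icc 0 b) :=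
      hv.comp continuousOn_snd fun q hq => hq.2
    have h1 : ContinuousOn (fun q : ℝ × ℝ => z + q.1 • u q.2) (Icc (-ε) ε ×ˢ Icc 0 b) :=
      continuousOn_const.add (continuousOn_fst.smul hu')
    have h2 : ∀ r : ℝ, ContinuousOn (fun q : ℝ × ℝ => ‖z + q.1 • u q.2‖ ^ r)
        (Icc (-ε) ε ×ˢ Icc 0 b) := fun r =>
      h1.norm.rpow_const fun q hq => Or.inl (norm_ne_zero_iff.2 (hne q.1 hq.1 q.2 hq.2))
    exact (((continuousOn_const.mul (h2 _)).mul (h1.inner hu')).mul (h1.inner hv')).sub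
      ((h2 _).mul (hu'.inner hv'))
  · intro x hx s hs
    exact hasDerivAt_pairForce α z (u s) (v s) x (hne x hx s hs)

/-- The eventual integrability is carried along because the action near `y = 0` has to be split into
a sum of pair integrals. -/
theorem hasDerivAt_integral_phi (hα : 1 < α) {z : ℝ → ℂ} (hb : 0 ≤ b) {d : ℝ} (hd : 0 < d)
    (hz : ∀ s ∈ Icc 0 b, d ≤ ‖z s‖) (hzc : ContinuousOn z (Icc 0 b))
    (hv : ContinuousOn v (Icc 0 b)) :
    (∀ᶠ y : ℝ in nhds 0, IntervalIntegrable (fun s => phi α ‖z s + y • v s‖) volume 0 b) ∧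
    HasDerivAt (fun y : ℝ => ∫ s in (0 : ℝ)..b, phi α ‖z s + y • v s‖)
      (∫ s in (0 : ℝ)..b, -(‖z s‖ ^ (-(α + 1)) * ⟪z s, v s⟫_ℝ)) 0 := by
  obtain ⟨C, hC⟩ := isCompact_Icc.exists_bound_of_continuousOn hv
  have hC0 : 0 ≤ C := (norm_nonneg _).trans (hC 0 ⟨le_rfl, hb⟩)
  set ε := d / (2 * (C + 1)) with hε
  have hεp : 0 < ε := by positivity
  have hne : ∀ x ∈ Icc (-ε) ε, ∀ s ∈ Icc 0 b, z s + x • v s ≠ 0 := by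
    intro x hx s hs
    refine add_smul_ne_zero (hC s hs) ?_
    calc |x| * (C + 1) ≤ ε * (C + 1) := by gcongr; exact abs_le.2 hx
      _ = d / 2 := by rw [hε]; field_simp
      _ < ‖z s‖ := by linarith [hz s hs]
  have hcont : ∀ x ∈ Icc (-ε) ε, ContinuousOn (fun s => phi α ‖z s + x • v s‖) (Icc 0 b) := by
    intro x hx
    have h1 : ContinuousOn (fun s => z s + x • v s) (Icc 0 b) := by fun_prop
    simp only [phi, hα.ne', if_false]
    exact (h1.norm.rpow_const
      fun s hs => Or.inl (norm_ne_zero_iff.2 (hne x hx s hs))).div_const _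
  refine ⟨?_, ?_⟩
  · filter_upwards [Icc_mem_nhds (show -ε < 0 by linarith) hεp] with x hx
    exact ContinuousOn.intervalIntegrable (by rw [uIcc_of_le hb]; exact hcont x hx)
  have := hasDerivAt_integral_of_continuousOn (b := b)
    (F := fun x s => phi α ‖z s + x • v s‖)
    (F' := fun x s => -(‖z s + x • v s‖ ^ (-(α + 1)) * ⟪z s + x • v s, v s⟫_ℝ)) hεp hb hcont ?_ ?_
  · simpa using this
  · have hz' : ContinuousOn (fun q : ℝ × ℝ => z q.2) (Icc (-ε) ε ×ˢ Icc 0 b) :=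
      hzc.comp continuousOn_snd fun q hq => hq.2
    have hv' : ContinuousOn (fun q : ℝ × ℝ => v q.2) (Icc (-ε) ε ×ˢ Icc 0 b) :=
      hv.comp continuousOn_snd fun q hq => hq.2
    have h1 : ContinuousOn (fun q : ℝ × ℝ => z q.2 + q.1 • v q.2) (Icc (-ε) ε ×ˢ Icc 0 b) :=
      hz'.add (continuousOn_fst.smul hv')
    exact ((h1.norm.rpow_const fun q hq =>
      Or.inl (norm_ne_zero_iff.2 (hne q.1 hq.1 q.2 hq.2))).mul (h1.inner hv')).neg
  · intro x hx s hs
    exact hasDerivAt_phi_norm hα (z s) (v s) x (hne x hx s hs)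

end PairIntegrals

/-! ### Kinetic energy along affine families of loops -/

/-- Polarisation. -/
theorem integrable_inner_of_memLp {X : Type*} [MeasurableSpace X] {μ : Measure X} {f g : X → ℂ}
    (hf : MemLp f 2 μ) (hg : MemLp g 2 μ) : Integrable (fun s => ⟪f s, g s⟫_ℝ) μ := by
  have h1 := (hf.add hg).integrable_norm_pow two_ne_zero
  have h2 := hf.integrable_norm_pow two_ne_zero
  have h3 := hg.integrable_norm_pow two_ne_zero
  refine (((h1.sub h2).sub h3).div_const 2).congr (Filter.Eventually.of_forall fun s => ?_)
  simp only [Pi.sub_apply, Pi.add_apply]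
  rw [norm_add_sq_real]
  ring

theorem intervalIntegrable_of_integrable_restrict {f : ℝ → ℝ} {b : ℝ} (hb : 0 ≤ b)
    (hf : Integrable f (volume.restrict (Ioc 0 b))) : IntervalIntegrable f volume 0 b := by
  rwa [intervalIntegrable_iff_integrableOn_Ioc_of_le hb]

theorem intervalIntegrable_finsetSum {ι E : Type*} [NormedAddCommGroup E] {S : Finset ι}
    {f : ι → ℝ → E} {b c : ℝ} (h : ∀ i ∈ S, IntervalIntegrable (f i) volume b c) :
    IntervalIntegrable (fun s => ∑ i ∈ S, f i s) volume b c := by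
  have h' := IntervalIntegrable.sum S h
  rwa [show (∑ i ∈ S, f i) = fun s => ∑ i ∈ S, f i s from funext fun s => by simp] at h'

theorem memLp_const_add_smul {b : ℝ} {U : ℝ → ℂ} (A : ℂ) (x : ℝ)
    (hU : MemLp U 2 (volume.restrict (Ioc 0 b))) :
    MemLp (fun s => A + x • U s) 2 (volume.restrict (Ioc 0 b)) :=
  (memLp_const A).add (hU.const_smul x)

section Kinetic

variable {b : ℝ} {W V : ℝ → ℂ}

theorem intervalIntegrable_norm_sq_add_smul (hb : 0 ≤ b)
    (hW : MemLp W 2 (volume.restrict (Ioc 0 b))) (hV : MemLp V 2 (volume.restrict (Ioc 0 b)))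
    (y : ℝ) : IntervalIntegrable (fun s => ‖W s + y • V s‖ ^ 2) volume 0 b :=
  intervalIntegrable_of_integrable_restrict hb
    ((hW.add (hV.const_smul y)).integrable_norm_pow two_ne_zero)

/-- Velocities are merely square integrable, so no compactness bound is available; the integral is
instead expanded exactly as a quadratic polynomial in `y`. -/
theorem hasDerivAt_integral_norm_sq (hb : 0 ≤ b)
    (hW : MemLp W 2 (volume.restrict (Ioc 0 b))) (hV : MemLp V 2 (volume.restrict (Ioc 0 b))) :
    HasDerivAt (fun y : ℝ => ∫ s in (0 : ℝ)..b, ‖W s + y • V s‖ ^ 2)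
      (2 * ∫ s in (0 : ℝ)..b, ⟪W s, V s⟫_ℝ) 0 := by
  have h1 := intervalIntegrable_of_integrable_restrict hb (hW.integrable_norm_pow two_ne_zero)
  have h2 := intervalIntegrable_of_integrable_restrict hb (integrable_inner_of_memLp hW hV)
  have h3 := intervalIntegrable_of_integrable_restrict hb (hV.integrable_norm_pow two_ne_zero)
  have h : ∀ y : ℝ, ∫ s in (0 : ℝ)..b, ‖W s + y • V s‖ ^ 2 =
      (∫ s in (0 : ℝ)..b, ‖W s‖ ^ 2) + (2 * y) * (∫ s in (0 : ℝ)..b, ⟪W s, V s⟫_ℝ) +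
        y ^ 2 * ∫ s in (0 : ℝ)..b, ‖V s‖ ^ 2 := by
    intro y
    rw [← intervalIntegral.integral_const_mul, ← intervalIntegral.integral_const_mul,
      ← intervalIntegral.integral_add h1 (h2.const_mul _),
      ← intervalIntegral.integral_add (h1.add (h2.const_mul _)) (h3.const_mul _)]
    refine intervalIntegral.integral_congr fun s _ => ?_
    simp only [norm_add_sq_real, norm_smul, inner_smul_right, Real.norm_eq_abs, mul_pow, sq_abs]
    ring
  simp only [h]
  have hd := (((hasDerivAt_id (0 : ℝ)).const_mul 2).mul_const
    (∫ s in (0 : ℝ)..b, ⟪W s, V s⟫_ℝ)).const_add (∫ s in (0 : ℝ)..b, ‖W s‖ ^ 2)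
  have hd2 := ((hasDerivAt_id (0 : ℝ)).pow 2).mul_const (∫ s in (0 : ℝ)..b, ‖V s‖ ^ 2)
  refine (hd.add hd2).congr_deriv ?_
  simp

end Kinetic

/-! ### First and second variation of the action -/

section Variation

variable {k : ℕ} {α : ℝ} {a : Fin k → ℂ} {u v : ℝ → Fin k → ℂ} {p : ℤ}

theorem action_const_add_eq (hu : u ∈ loopSpace fun _ : Fin k => (1 : ℝ))
    (hv : v ∈ loopSpace fun _ : Fin k => (1 : ℝ)) (x y : ℝ) :
    action α (fun _ => 1) p ((fun _ => a) + x • u + y • v) =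
      ∫ s in (0 : ℝ)..(2 * π),
        (1 / 2 * ∑ j, ‖(Complex.I * a j + x • velocity p u s j) + y • velocity p v s j‖ ^ 2 +
          ∑ i, ∑ j ∈ Finset.Ioi i,
            phi α ‖((a i - a j) + x • (u s i - u s j)) + y • (v s i - v s j)‖) := by
  refine intervalIntegral.integral_congr_ae ?_
  filter_upwards [ae_differentiableAt_of_mem_loopSpace hu,
    ae_differentiableAt_of_mem_loopSpace hv] with s hsu hsv hs
  congr 1
  · congr 1
    refine Finset.sum_congr rfl fun j _ => ?_
    rw [one_mul, ← velocity_const_add a p x y (hsu hs) (hsv hs) j]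
    rfl
  · refine Finset.sum_congr rfl fun i _ => Finset.sum_congr rfl fun j _ => ?_
    rw [one_mul, one_mul]
    congr 2
    simp only [Pi.add_apply, Pi.smul_apply, Complex.real_smul]
    ring

theorem eventually_norm_add_smul_ge {b : ℝ} {z : ℂ} {w : ℝ → ℂ} (hz : z ≠ 0) (hb : 0 ≤ b)
    (hw : ContinuousOn w (Icc 0 b)) :
    ∀ᶠ x : ℝ in nhds 0, ∀ s ∈ Icc 0 b, ‖z‖ / 2 ≤ ‖z + x • w s‖ := by
  obtain ⟨C, hC⟩ := isCompact_Icc.exists_bound_of_continuousOn hw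
  have hC0 : 0 ≤ C := (norm_nonneg _).trans (hC 0 ⟨le_rfl, hb⟩)
  have hzp := norm_pos_iff.2 hz
  have hε : 0 < ‖z‖ / (2 * (C + 1)) := by positivity
  filter_upwards [Icc_mem_nhds (neg_lt_zero.2 hε) hε] with x hx s hs
  have h1 : ‖x • w s‖ ≤ ‖z‖ / 2 := by
    rw [norm_smul, Real.norm_eq_abs]
    calc |x| * ‖w s‖ ≤ ‖z‖ / (2 * (C + 1)) * (C + 1) := by
          gcongr
          · exact abs_le.2 hx
          · linarith [hC s hs]
      _ = ‖z‖ / 2 := by field_simp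
  have h2 := norm_sub_le (z + x • w s) (x • w s)
  rw [add_sub_cancel_right] at h2
  linarith

theorem hasDerivAt_action (hα : 1 < α) (hu : u ∈ loopSpace fun _ : Fin k => (1 : ℝ))
    (hv : v ∈ loopSpace fun _ : Fin k => (1 : ℝ)) {x : ℝ}
    (hx : ∀ i j, i < j → ∃ d > 0, ∀ s ∈ Icc 0 (2 * π),
      d ≤ ‖(a i - a j) + x • (u s i - u s j)‖) :
    HasDerivAt (fun y : ℝ => action α (fun _ => 1) p ((fun _ => a) + x • u + y • v))
      ((∑ j, ∫ s in (0 : ℝ)..(2 * π),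
          ⟪Complex.I * a j + x • velocity p u s j, velocity p v s j⟫_ℝ) +
        ∑ i, ∑ j ∈ Finset.Ioi i, ∫ s in (0 : ℝ)..(2 * π),
          -(‖(a i - a j) + x • (u s i - u s j)‖ ^ (-(α + 1)) *
            ⟪(a i - a j) + x • (u s i - u s j), v s i - v s j⟫_ℝ)) 0 := by
  have hpi : 0 ≤ 2 * π := two_pi_pos.le
  have hcu := fun i j =>
    (continuousOn_of_mem_loopSpace hu i).sub (continuousOn_of_mem_loopSpace hu j)
  have hcv := fun i j =>
    (continuousOn_of_mem_loopSpace hv i).sub (continuousOn_of_mem_loopSpace hv j)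
  have hW := fun j => memLp_const_add_smul (Complex.I * a j) x (memLp_velocity hu p j)
  have hV := fun j => memLp_velocity hv p j
  have hK := fun j => hasDerivAt_integral_norm_sq hpi (hW j) (hV j)
  have hKi := fun j => intervalIntegrable_norm_sq_add_smul hpi (hW j) (hV j)
  have hP : ∀ i j, i < j → _ := fun i j hij =>
    let ⟨d, hd, h⟩ := hx i j hij
    hasDerivAt_integral_phi hα hpi hd h (continuousOn_const.add ((hcu i j).const_smul x)) (hcv i j)
  have hPi : ∀ᶠ y : ℝ in nhds 0, ∀ i j, i < j → IntervalIntegrable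
      (fun s => phi α ‖((a i - a j) + x • (u s i - u s j)) + y • (v s i - v s j)‖)
      volume 0 (2 * π) := by
    simp only [Filter.eventually_all]
    exact fun i j hij => (hP i j hij).1
  have hsum := (HasDerivAt.fun_sum fun (j : Fin k) (_ : j ∈ Finset.univ) =>
      (hK j)).const_mul (1 / 2 : ℝ)
  have hsum2 := HasDerivAt.fun_sum fun (i : Fin k) (_ : i ∈ Finset.univ) =>
    HasDerivAt.fun_sum fun (j : Fin k) (hj : j ∈ Finset.Ioi i) => (hP i j (Finset.mem_Ioi.1 hj)).2
  refine ((hsum.add hsum2).congr_deriv ?_).congr_of_eventuallyEq ?_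
  · congr 1
    rw [← Finset.mul_sum]
    ring
  · filter_upwards [hPi] with y hy
    rw [action_const_add_eq hu hv x y, intervalIntegral.integral_add,
      intervalIntegral.integral_const_mul, intervalIntegral.integral_finsetSum,
      intervalIntegral.integral_finsetSum]
    · simp only [Pi.add_apply]
      congr 1
      refine Finset.sum_congr rfl fun i _ => ?_
      exact intervalIntegral.integral_finsetSum fun j hj => hy i j (Finset.mem_Ioi.1 hj)
    · intro i _
      exact intervalIntegrable_finsetSum fun j hj => hy i j (Finset.mem_Ioi.1 hj)
    · exact fun j _ => hKi j y
    · exact (intervalIntegrable_finsetSum fun j _ => hKi j y).const_mul _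
    · exact intervalIntegrable_finsetSum fun i _ =>
        intervalIntegrable_finsetSum fun j hj => hy i j (Finset.mem_Ioi.1 hj)

theorem hessian_action_eq_sum (hα : 1 < α) (ha : Function.Injective a)
    (hu : u ∈ loopSpace fun _ : Fin k => (1 : ℝ))
    (hv : v ∈ loopSpace fun _ : Fin k => (1 : ℝ)) :
    hessian (action α (fun _ => 1) p) (fun _ => a) u v =
      (∑ j, ∫ s in (0 : ℝ)..(2 * π), ⟪velocity p u s j, velocity p v s j⟫_ℝ) +
        ∑ i, ∑ j ∈ Finset.Ioi i, ∫ s in (0 : ℝ)..(2 * π),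
          pairHessian α (a i - a j) (u s i - u s j) (v s i - v s j) := by
  have hpi : 0 ≤ 2 * π := two_pi_pos.le
  have hcu := fun i j =>
    (continuousOn_of_mem_loopSpace hu i).sub (continuousOn_of_mem_loopSpace hu j)
  have hcv := fun i j =>
    (continuousOn_of_mem_loopSpace hv i).sub (continuousOn_of_mem_loopSpace hv j)
  have hne : ∀ i j : Fin k, i < j → a i - a j ≠ 0 := fun i j hij =>
    sub_ne_zero.2 (ha.ne hij.ne)
  -- The inner derivative must be known for all `x` near `0`, not only at `0`, before the outer one
  -- can be taken; uniform distance from collisions provides this.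
  have hev : ∀ᶠ x : ℝ in nhds 0, ∀ i j, i < j → ∃ d > 0, ∀ s ∈ Icc 0 (2 * π),
      d ≤ ‖(a i - a j) + x • (u s i - u s j)‖ := by
    simp only [Filter.eventually_all]
    intro i j hij
    filter_upwards [eventually_norm_add_smul_ge (hne i j hij) hpi (hcu i j)] with x hx
    exact ⟨_, by have := norm_pos_iff.2 (hne i j hij); positivity, hx⟩
  have hinner := hev.mono fun x hx => (hasDerivAt_action (p := p) hα hu hv hx).deriv
  rw [hessian, Filter.EventuallyEq.deriv_eq hinner]
  refine HasDerivAt.deriv (HasDerivAt.add (HasDerivAt.fun_sum fun j _ => ?_)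
    (HasDerivAt.fun_sum fun i _ => HasDerivAt.fun_sum fun j hj =>
      hasDerivAt_integral_pairForce (hne i j (Finset.mem_Ioi.1 hj)) hpi (hcu i j) (hcv i j)))
  have h1 : ∀ x : ℝ, ∫ s in (0 : ℝ)..(2 * π),
      ⟪Complex.I * a j + x • velocity p u s j, velocity p v s j⟫_ℝ =
      (∫ s in (0 : ℝ)..(2 * π), ⟪Complex.I * a j, velocity p v s j⟫_ℝ) +
        x * ∫ s in (0 : ℝ)..(2 * π), ⟪velocity p u s j, velocity p v s j⟫_ℝ := by
    intro x
    rw [← intervalIntegral.integral_const_mul, ← intervalIntegral.integral_add]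
    · refine intervalIntegral.integral_congr fun s _ => ?_
      simp only [inner_add_left, inner_smul_left, RCLike.conj_to_real]
    · exact intervalIntegrable_of_integrable_restrict hpi
        (integrable_inner_of_memLp (memLp_const _) (memLp_velocity hv p j))
    · exact (intervalIntegrable_of_integrable_restrict hpi
        (integrable_inner_of_memLp (memLp_velocity hu p j) (memLp_velocity hv p j))).const_mul _
  simp only [h1]
  refine (((hasDerivAt_id (0 : ℝ)).mul_const _).const_add _).congr_deriv ?_
  simp

end Variation

/-! ### Symmetrised pair sums and the complex form of the second variation -/

/-- Action and reaction: antisymmetry of `T` turns a sum over pairs into a sum over bodies. -/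
theorem sum_Ioi_sub_mul_eq {k : ℕ} {T : Fin k → Fin k → ℂ} (hT : ∀ i j, T j i = -T i j)
    (c : Fin k → ℂ) :
    ∑ i, ∑ j ∈ Finset.Ioi i, (c i - c j) * T i j = ∑ i, c i * ∑ j, T i j := by
  have h1 : ∀ F : Fin k → Fin k → ℂ,
      ∑ i, ∑ j ∈ Finset.Ioi i, F i j = ∑ i, ∑ j, if i < j then F i j else 0 := by
    intro F
    refine Finset.sum_congr rfl fun i _ => ?_
    rw [← Finset.sum_filter]
    congr 1
    ext j; simp
  have h2 : ∑ i, ∑ j ∈ Finset.Ioi i, (c i - c j) * T i j =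
      (∑ i, ∑ j ∈ Finset.Ioi i, c i * T i j) + ∑ i, ∑ j ∈ Finset.Ioi i, c j * T j i := by
    rw [← Finset.sum_add_distrib]
    refine Finset.sum_congr rfl fun i _ => ?_
    rw [← Finset.sum_add_distrib]
    refine Finset.sum_congr rfl fun j _ => ?_
    rw [hT i j]; ring
  rw [h2, h1, h1, Finset.sum_comm (s := Finset.univ) (t := Finset.univ)
    (f := fun i j => if i < j then c j * T j i else 0), ← Finset.sum_add_distrib]
  refine Finset.sum_congr rfl fun i _ => ?_
  rw [← Finset.sum_add_distrib, Finset.mul_sum]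
  refine Finset.sum_congr rfl fun j _ => ?_
  rcases lt_trichotomy i j with h | h | h
  · simp [h, h.not_gt]
  · subst h
    have : T i i = 0 := self_eq_neg.1 (hT i i)
    simp [this]
  · simp [h, h.not_gt]

/-- The linearisation of the pair force at the separation `z`, as a real-linear operator on `ℂ`. -/
def pairOp (α : ℝ) (z u : ℂ) : ℂ :=
  ((‖z‖ ^ (-(α + 1)) : ℝ) : ℂ) *
    ((((α - 1) / 2 : ℝ) : ℂ) * u + (((α + 1) / 2 : ℝ) : ℂ) * (z ^ 2 / (‖z‖ : ℂ) ^ 2) * conj u)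

/-- Rests on `2 ⟪z, u⟫ z = ‖z‖² u + z² conj u`, which splits the Hessian into a complex-linear and a
conjugate-linear part. -/
theorem pairHessian_eq_re {α : ℝ} {z : ℂ} (hz : z ≠ 0) (u v : ℂ) :
    pairHessian α z u v = (conj v * pairOp α z u).re := by
  have hn : 0 < ‖z‖ := norm_pos_iff.2 hz
  have hpow : ‖z‖ ^ (-(α + 3)) = ‖z‖ ^ (-(α + 1)) / ‖z‖ ^ 2 := by
    rw [← Real.rpow_natCast ‖z‖ 2, ← Real.rpow_sub hn]
    congr 1; push_cast; ring
  have hsq : ‖z‖ ^ 2 = z.re * z.re + z.im * z.im := by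
    rw [← Complex.normSq_eq_norm_sq, Complex.normSq_apply]
  have hq : (z ^ 2 / (‖z‖ : ℂ) ^ 2) = ((1 / ‖z‖ ^ 2 : ℝ) : ℂ) * z ^ 2 := by
    push_cast; ring
  have hN : ‖z‖ ^ 2 ≠ 0 := by positivity
  simp only [pairHessian, pairOp, hq, hpow, Complex.inner]
  generalize ‖z‖ ^ (-(α + 1)) = g
  generalize ‖z‖ ^ 2 = N at *
  simp only [Complex.mul_re, Complex.mul_im, Complex.add_re, Complex.add_im, Complex.conj_re,
    Complex.conj_im, Complex.ofReal_re, Complex.ofReal_im, pow_two]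
  field_simp
  linear_combination -(g * (α + 1) * (u.re * v.re + u.im * v.im)) * hsq

theorem pairOp_neg_neg (α : ℝ) (z u : ℂ) : pairOp α (-z) (-u) = -pairOp α z u := by
  simp only [pairOp, norm_neg, map_neg, neg_sq]
  ring

theorem continuous_pairOp (α : ℝ) (z : ℂ) : Continuous (pairOp α z) := by
  unfold pairOp
  exact continuous_const.mul ((continuous_const.mul continuous_id).add
    (continuous_const.mul Complex.continuous_conj))

/-- The second derivative of the potential at `a`, as a real-linear operator. -/
def hessianOp {k : ℕ} (α : ℝ) (a u : Fin k → ℂ) (i : Fin k) : ℂ :=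
  ∑ j, pairOp α (a i - a j) (u i - u j)

theorem sum_pairHessian_eq {k : ℕ} {α : ℝ} {a : Fin k → ℂ} (ha : Function.Injective a)
    (u v : Fin k → ℂ) :
    ∑ i, ∑ j ∈ Finset.Ioi i, pairHessian α (a i - a j) (u i - u j) (v i - v j) =
      (∑ i, conj (v i) * hessianOp α a u i).re := by
  have hT : ∀ i j, pairOp α (a j - a i) (u j - u i) = -pairOp α (a i - a j) (u i - u j) := by
    intro i j
    rw [← pairOp_neg_neg, neg_sub, neg_sub]
  unfold hessianOp
  rw [← sum_Ioi_sub_mul_eq hT fun i => conj (v i), Complex.re_sum]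
  refine Finset.sum_congr rfl fun i _ => ?_
  rw [Complex.re_sum]
  refine Finset.sum_congr rfl fun j hj => ?_
  rw [pairHessian_eq_re (sub_ne_zero.2 (ha.ne (Finset.mem_Ioi.1 hj).ne)), map_sub]

section SecondVariation

variable {k : ℕ} {α : ℝ} {a : Fin k → ℂ} {u v : ℝ → Fin k → ℂ} {p : ℤ}

theorem continuousOn_hessianOp {m : Fin k → ℝ} (hu : u ∈ loopSpace m) (i : Fin k) :
    ContinuousOn (fun s => hessianOp α a (u s) i) (Icc 0 (2 * π)) :=
  continuousOn_finsetSum _ fun j _ => (continuous_pairOp α _).comp_continuousOn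
    ((continuousOn_of_mem_loopSpace hu i).sub (continuousOn_of_mem_loopSpace hu j))

theorem continuousOn_pairHessian {b : ℝ} {f g : ℝ → ℂ} {z : ℂ} (hf : ContinuousOn f (Icc 0 b))
    (hg : ContinuousOn g (Icc 0 b)) :
    ContinuousOn (fun s => pairHessian α z (f s) (g s)) (Icc 0 b) := by
  unfold pairHessian
  exact ((continuousOn_const.mul (continuousOn_const.inner hf)).mul
    (continuousOn_const.inner hg)).sub (continuousOn_const.mul (hf.inner hg))

theorem intervalIntegrable_conj_velocity_mul {m : Fin k → ℝ} (hu : u ∈ loopSpace m)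
    (hv : v ∈ loopSpace m) (j : Fin k) :
    IntervalIntegrable (fun s => conj (velocity p v s j) * velocity p u s j)
      volume 0 (2 * π) := by
  rw [intervalIntegrable_iff_integrableOn_Ioc_of_le two_pi_pos.le]
  have hc : MemLp (fun s => conj (velocity p v s j)) 2 (volume.restrict (Ioc 0 (2 * π))) :=
    (Complex.conjCLE : ℂ →L[ℝ] ℂ).comp_memLp' (memLp_velocity hv p j)
  exact hc.integrable_mul (memLp_velocity hu p j)

theorem hessian_action_eq (hα : 1 < α) (ha : Function.Injective a)
    (hu : u ∈ loopSpace fun _ : Fin k => (1 : ℝ))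
    (hv : v ∈ loopSpace fun _ : Fin k => (1 : ℝ)) :
    hessian (action α (fun _ => 1) p) (fun _ => a) u v =
      ((∑ j, ∫ s in (0 : ℝ)..(2 * π), conj (velocity p v s j) * velocity p u s j) +
        ∑ j, ∫ s in (0 : ℝ)..(2 * π), conj (v s j) * hessianOp α a (u s) j).re := by
  have hpi : 0 ≤ 2 * π := two_pi_pos.le
  have hvi : ∀ j, ContinuousOn (fun s => conj (v s j) * hessianOp α a (u s) j)
      (uIcc 0 (2 * π)) := fun j => by
    rw [uIcc_of_le hpi]
    exact (Complex.continuous_conj.comp_continuousOn (continuousOn_of_mem_loopSpace hv j)).mul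
      (continuousOn_hessianOp hu j)
  rw [hessian_action_eq_sum hα ha hu hv, Complex.add_re, Complex.re_sum]
  congr 1
  · refine Finset.sum_congr rfl fun j _ => ?_
    refine Eq.trans ?_ (Complex.reCLM.intervalIntegral_comp_comm
      (intervalIntegrable_conj_velocity_mul (p := p) hu hv j))
    refine intervalIntegral.integral_congr fun s _ => ?_
    simp only [Complex.inner, Complex.reCLM_apply, Complex.mul_re, Complex.conj_re,
      Complex.conj_im]
    ring
  · rw [← intervalIntegral.integral_finsetSum fun j _ => (hvi j).intervalIntegrable]
    refine Eq.trans ?_ (Complex.reCLM.intervalIntegral_comp_comm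
      (intervalIntegrable_finsetSum fun j _ => (hvi j).intervalIntegrable))
    have hint : ∀ i j : Fin k, IntervalIntegrable
        (fun s => pairHessian α (a i - a j) (u s i - u s j) (v s i - v s j))
        volume 0 (2 * π) := fun i j => by
      refine ContinuousOn.intervalIntegrable ?_
      rw [uIcc_of_le hpi]
      exact continuousOn_pairHessian
        ((continuousOn_of_mem_loopSpace hu i).sub (continuousOn_of_mem_loopSpace hu j))
        ((continuousOn_of_mem_loopSpace hv i).sub (continuousOn_of_mem_loopSpace hv j))
    simp only [Complex.reCLM_apply, ← sum_pairHessian_eq ha]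
    rw [intervalIntegral.integral_finsetSum fun i _ => intervalIntegrable_finsetSum
      fun j _ => hint i j]
    exact Finset.sum_congr rfl fun i _ =>
      (intervalIntegral.integral_finsetSum fun j _ => hint i j).symm

end SecondVariation

/-! ### Central configurations -/

section Central

variable {k : ℕ} {α : ℝ} {a : Fin k → ℂ}

/-- The hypothesis is the equation `∇U(a) = -a`; the diagonal term `j = i` contributes zero. -/
theorem sum_pairForce_eq
    (hcc : ∀ i, ∑ j, ((‖a i - a j‖ ^ (-(α + 1)) : ℝ) : ℂ) * (a i - a j) = a i)
    (v : Fin k → ℂ) :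
    ∑ i, ∑ j ∈ Finset.Ioi i, -(‖a i - a j‖ ^ (-(α + 1)) * ⟪a i - a j, v i - v j⟫_ℝ) =
      -∑ i, ⟪a i, v i⟫_ℝ := by
  have hT : ∀ i j, ((‖a j - a i‖ ^ (-(α + 1)) : ℝ) : ℂ) * (a j - a i) =
      -(((‖a i - a j‖ ^ (-(α + 1)) : ℝ) : ℂ) * (a i - a j)) := by
    intro i j
    rw [norm_sub_rev]; ring
  have h := congrArg Complex.re (sum_Ioi_sub_mul_eq hT fun i => conj (v i))
  simp only [hcc, Complex.re_sum] at h
  have hin : ∀ (g : ℝ) (z w : ℂ), (conj w * ((g : ℂ) * z)).re = g * ⟪z, w⟫_ℝ := by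
    intro g z w
    simp only [Complex.inner, Complex.mul_re, Complex.conj_re, Complex.conj_im,
      Complex.ofReal_re, Complex.ofReal_im, Complex.mul_im]
    ring
  have hin1 : ∀ z w : ℂ, (conj w * z).re = ⟪z, w⟫_ℝ := fun z w => by simp
  simp only [← map_sub, hin, hin1] at h
  simp only [Finset.sum_neg_distrib, h]

theorem hasFDerivAt_phi_norm (hα : 1 < α) {z : ℂ} (hz : z ≠ 0) :
    HasFDerivAt (fun w : ℂ => phi α ‖w‖) (-(‖z‖ ^ (-(α + 1))) • innerSL ℝ z) z := by
  have hn := norm_pos_iff.2 hz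
  have h1 := ((hasStrictFDerivAt_norm_sq z).hasFDerivAt.rpow_const (p := (1 - α) / 2)
    (Or.inl (by positivity))).mul_const (α - 1)⁻¹
  have hpow : ∀ (w : ℂ) (r : ℝ), (‖w‖ ^ 2) ^ (r / 2) = ‖w‖ ^ r := by
    intro w r
    rw [← Real.rpow_natCast, ← Real.rpow_mul (norm_nonneg _)]
    congr 1; push_cast; ring
  rw [show (1 - α) / 2 - 1 = (-(α + 1)) / 2 by ring] at h1
  simp only [hpow] at h1
  simp only [phi, hα.ne', if_false, div_eq_mul_inv]
  refine h1.congr_fderiv ?_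
  ext v
  have : α - 1 ≠ 0 := by linarith
  simp only [smul_apply, smul_eq_mul, nsmul_eq_mul]
  simp
  field_simp
  ring

theorem isCentralConfiguration_of_sum_eq (hα : 1 < α) (ha : Function.Injective a)
    (hcent : ∑ j, a j = 0)
    (hcc : ∀ i, ∑ j, ((‖a i - a j‖ ^ (-(α + 1)) : ℝ) : ℂ) * (a i - a j) = a i) :
    IsCentralConfiguration α (fun _ : Fin k => (1 : ℝ)) a := by
  refine ⟨ha, by simpa using hcent, ?_⟩
  let P : Fin k → ((Fin k → ℂ) →L[ℝ] ℂ) := fun j =>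
    ContinuousLinearMap.proj (R := ℝ) (φ := fun _ : Fin k => ℂ) j
  have hP : ∀ j, HasFDerivAt (fun w : Fin k → ℂ => w j) (P j) a := fun j => (P j).hasFDerivAt
  have h1 := (HasFDerivAt.fun_sum fun (j : Fin k) (_ : j ∈ Finset.univ) =>
    ((hP j).norm_sq).const_mul (1 : ℝ)).const_mul (1 / 2 : ℝ)
  have h2 := HasFDerivAt.fun_sum fun (i : Fin k) (_ : i ∈ Finset.univ) =>
    HasFDerivAt.fun_sum fun (j : Fin k) (hj : j ∈ Finset.Ioi i) =>
      ((hasFDerivAt_phi_norm hα (sub_ne_zero.2 (ha.ne (Finset.mem_Ioi.1 hj).ne))).comp a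
        ((hP i).sub (hP j))).const_mul ((1 : ℝ) * 1)
  refine (h1.add h2).congr_fderiv ?_
  ext v
  have h3 := sum_pairForce_eq hcc v
  simp only [add_apply, smul_apply,
    sum_apply, ContinuousLinearMap.comp_apply, sub_apply,
    innerSL_apply_apply, smul_eq_mul, one_mul, zero_apply,
    neg_mul, P, ContinuousLinearMap.proj_apply, nsmul_eq_mul]
  rw [h3, ← Finset.mul_sum]
  push_cast
  ring

/-- In the kinetic term the part with `deriv v` integrates to zero over a period; what remains is
`⟪a, v⟫`, cancelled by the potential force. -/
theorem hasDerivAt_action_centralConfiguration (hα : 1 < α) (ha : Function.Injective a)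
    (hcc : ∀ i, ∑ j, ((‖a i - a j‖ ^ (-(α + 1)) : ℝ) : ℂ) * (a i - a j) = a i) (p : ℤ)
    {v : ℝ → Fin k → ℂ} (hv : v ∈ loopSpace fun _ : Fin k => (1 : ℝ)) :
    HasDerivAt (fun y : ℝ => action α (fun _ => 1) p ((fun _ => a) + y • v)) 0 0 := by
  have hpi : 0 ≤ 2 * π := two_pi_pos.le
  have h0 : (fun _ => 0 : ℝ → Fin k → ℂ) ∈ loopSpace fun _ : Fin k => (1 : ℝ) :=
    const_mem_loopSpace (by simp)
  have h := hasDerivAt_action (p := p) (a := a) (x := 0) hα h0 hv fun i j hij =>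
    ⟨‖a i - a j‖, norm_pos_iff.2 (sub_ne_zero.2 (ha.ne hij.ne)), fun s _ => by simp⟩
  simp only [zero_smul, add_zero] at h
  refine h.congr_deriv ?_
  have hcv := fun i => continuousOn_of_mem_loopSpace hv i
  have hvint : ∀ c : ℂ, ∀ j, IntervalIntegrable (fun s => ⟪c, v s j⟫_ℝ) volume 0 (2 * π) :=
    fun c j => ContinuousOn.intervalIntegrable
      (by rw [uIcc_of_le hpi]; exact continuousOn_const.inner (hcv j))
  have h1 : ∀ j, ∫ s in (0 : ℝ)..(2 * π), ⟪Complex.I * a j, velocity p v s j⟫_ℝ =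
      ∫ s in (0 : ℝ)..(2 * π), ⟪a j, v s j⟫_ℝ := by
    intro j
    have hd := (innerSL ℝ (Complex.I * a j)).intervalIntegral_comp_comm
      (intervalIntegrable_deriv_apply hv j)
    rw [integral_deriv_apply_eq_zero hv j, map_zero] at hd
    simp only [innerSL_apply_apply] at hd
    have hdi : IntervalIntegrable (fun s => ⟪Complex.I * a j, deriv v s j⟫_ℝ)
        volume 0 (2 * π) := by
      rw [intervalIntegrable_iff_integrableOn_Ioc_of_le hpi]
      exact (((memLp_deriv_apply hv j).integrable (by norm_num)).const_inner _)
    have : ∀ s, ⟪Complex.I * a j, velocity p v s j⟫_ℝ =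
        (1 / p : ℝ) * ⟪Complex.I * a j, deriv v s j⟫_ℝ + ⟪a j, v s j⟫_ℝ := by
      intro s
      simp only [velocity, Complex.inner, Complex.mul_re, Complex.mul_im, Complex.conj_re,
        Complex.conj_im, Complex.add_re, Complex.add_im, Complex.I_re, Complex.I_im,
        Complex.ofReal_re, Complex.ofReal_im]
      ring
    simp only [this]
    rw [intervalIntegral.integral_add (hdi.const_mul _) (hvint _ j),
      intervalIntegral.integral_const_mul, hd]
    ring
  have hpair : ∀ i j : Fin k, IntervalIntegrable
      (fun s => -(‖a i - a j‖ ^ (-(α + 1)) * ⟪a i - a j, v s i - v s j⟫_ℝ))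
      volume 0 (2 * π) := fun i j => ContinuousOn.intervalIntegrable (by
        rw [uIcc_of_le hpi]
        exact (continuousOn_const.mul (continuousOn_const.inner ((hcv i).sub (hcv j)))).neg)
  simp only [h1]
  rw [← intervalIntegral.integral_finsetSum fun j _ => hvint _ j,
    Finset.sum_congr rfl fun i _ =>
      (intervalIntegral.integral_finsetSum fun j _ => hpair i j).symm,
    ← intervalIntegral.integral_finsetSum fun i _ => intervalIntegrable_finsetSum
      fun j _ => hpair i j,
    ← intervalIntegral.integral_add (intervalIntegrable_finsetSum fun j _ => hvint _ j)
      (intervalIntegrable_finsetSum fun i _ => intervalIntegrable_finsetSum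
      fun j _ => hpair i j)]
  simp only [sum_pairForce_eq hcc, add_neg_cancel, intervalIntegral.integral_zero]

end Central

/-! ### Roots of unity indexed by `Fin k` -/

/-- The primitive `k`-th root of unity `exp (2πi/k)`. -/
def zeta (k : ℕ) : ℂ := Complex.exp (2 * π * Complex.I / k)

/-- The `l`-th power of the primitive root. -/
def root {k : ℕ} (l : Fin k) : ℂ := zeta k ^ (l : ℕ)

/-- The vertices of the regular `k`-gon of circumradius one, numbered as in `polygon`. -/
def vertex {k : ℕ} (j : Fin k) : ℂ := zeta k ^ ((j : ℕ) + 1)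

section Roots

variable {k : ℕ}

theorem zeta_ne_zero : zeta k ≠ 0 := Complex.exp_ne_zero _

theorem norm_zeta : ‖zeta k‖ = 1 := by
  have : zeta k = Complex.exp ((2 * π / k : ℝ) * Complex.I) := by
    rw [zeta]; congr 1; push_cast; ring
  rw [this, Complex.norm_exp_ofReal_mul_I]

theorem norm_root (l : Fin k) : ‖root l‖ = 1 := by simp [root, norm_zeta]

theorem norm_vertex (l : Fin k) : ‖vertex l‖ = 1 := by simp [vertex, norm_zeta]

theorem root_ne_zero (l : Fin k) : root l ≠ 0 := pow_ne_zero _ zeta_ne_zero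

theorem vertex_ne_zero (l : Fin k) : vertex l ≠ 0 := pow_ne_zero _ zeta_ne_zero

theorem conj_eq_inv_of_norm_eq_one {z : ℂ} (h : ‖z‖ = 1) : conj z = z⁻¹ := by
  rw [Complex.inv_def, Complex.normSq_eq_norm_sq, h]; simp

theorem polygon_eq (α : ℝ) (j : Fin k) :
    polygon k α j = ((sOne k α ^ (1 / (α + 1)) : ℝ) : ℂ) * vertex j := by
  rw [polygon, vertex, zeta, ← Complex.exp_nat_mul]
  congr 2
  push_cast; ring

variable [NeZero k]

theorem isPrimitiveRoot_zeta : IsPrimitiveRoot (zeta k) k :=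
  Complex.isPrimitiveRoot_exp k (NeZero.ne k)

theorem zeta_pow_mod (n : ℕ) : zeta k ^ (n % k) = zeta k ^ n :=
  (pow_eq_pow_mod n isPrimitiveRoot_zeta.pow_eq_one).symm

theorem root_zero : root (0 : Fin k) = 1 := by simp [root]

theorem root_one : root (1 : Fin k) = zeta k :=
  (zeta_pow_mod 1).trans (pow_one _)

theorem root_add (i l : Fin k) : root (i + l) = root i * root l := by
  rw [root, Fin.val_add, zeta_pow_mod, pow_add]; rfl

/-- Addition in `Fin k` acts on the vertices as rotation; this is the symmetry behind the circulant
structure. -/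
theorem vertex_add (i l : Fin k) : vertex (i + l) = vertex i * root l := by
  rw [vertex, pow_succ, Fin.val_add, zeta_pow_mod, pow_add, vertex, root]; ring

theorem root_neg (l : Fin k) : root (-l) = (root l)⁻¹ := by
  refine eq_inv_of_mul_eq_one_left ?_
  rw [← root_add, neg_add_cancel, root_zero]

theorem root_pow_card (l : Fin k) : root l ^ k = 1 := by
  rw [root, ← pow_mul, mul_comm, pow_mul, isPrimitiveRoot_zeta.pow_eq_one, one_pow]

theorem vertex_pow_card (l : Fin k) : vertex l ^ k = 1 := by
  rw [vertex, ← pow_mul, mul_comm, pow_mul, isPrimitiveRoot_zeta.pow_eq_one, one_pow]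

theorem root_eq_one_iff {l : Fin k} : root l = 1 ↔ l = 0 := by
  refine ⟨fun h => ?_, fun h => by rw [h, root_zero]⟩
  have h1 := (isPrimitiveRoot_zeta (k := k)).pow_inj l.isLt (NeZero.pos k)
    (by rw [pow_zero]; exact h)
  exact Fin.ext (by simpa using h1)

theorem vertex_injective : Function.Injective (vertex (k := k)) := by
  intro i j h
  have h1 : vertex i * root (j - i) = vertex i := by rw [← vertex_add, add_sub_cancel, h]
  have h2 := root_eq_one_iff.1 (mul_left_cancel₀ (vertex_ne_zero i) (h1.trans (mul_one _).symm))
  exact (sub_eq_zero.1 h2).symm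

theorem sum_vertex_zpow_eq_zero {m : ℤ} (hm : ¬ (k : ℤ) ∣ m) :
    ∑ j : Fin k, vertex j ^ m = 0 := by
  have h1 : ∑ j : Fin k, vertex (j + 1) ^ m = ∑ j : Fin k, vertex j ^ m :=
    Equiv.sum_comp (Equiv.addRight (1 : Fin k)) fun j => vertex j ^ m
  simp only [vertex_add, mul_zpow, ← Finset.sum_mul] at h1
  have h2 : root (1 : Fin k) ^ m ≠ 1 := by
    rw [root_one]
    exact fun h => hm (isPrimitiveRoot_zeta.zpow_eq_one_iff_dvd m |>.1 h)
  have h3 : (∑ j : Fin k, vertex j ^ m) * (root (1 : Fin k) ^ m - 1) = 0 := by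
    rw [mul_sub, h1]; ring
  exact (mul_eq_zero.1 h3).resolve_right (sub_ne_zero.2 h2)

theorem sum_root_pow_eq_zero {l : Fin k} (hl : l ≠ 0) :
    ∑ m ∈ Finset.range k, root l ^ m = 0 := by
  have h1 : root l ≠ 1 := fun h => hl (root_eq_one_iff.1 h)
  rw [geom_sum_eq h1, root_pow_card, sub_self, zero_div]

end Roots

/-! ### The Hessian of the polygon in discrete Fourier modes -/

section Modes

variable {k : ℕ}

/-- The factor `‖a_i - a_{i+l}‖ ^ (-(α+1))` of the regular `k`-gon of circumradius `r`. -/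
def gauge (α r : ℝ) (l : Fin k) : ℝ := (r * ‖1 - root l‖) ^ (-(α + 1))

/-- The circulant symbol `∑_l g_l (1 - cos (2π l m / k))`. -/
def symbol (k : ℕ) (α r : ℝ) (m : ℤ) : ℝ := ∑ l : Fin k, gauge α r l * (1 - (root l ^ m).re)

/-- The discrete Fourier coefficients of a configuration in the rotating frame. -/
def mode (m : ℤ) (u : Fin k → ℂ) : ℂ := ∑ i, vertex i ^ (-(m + 1)) * u i

variable {α r : ℝ}

theorem symbol_zero : symbol k α r 0 = 0 := by simp [symbol]

theorem symbol_nonneg (hr : 0 ≤ r) (m : ℤ) : 0 ≤ symbol k α r m := by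
  refine Finset.sum_nonneg fun l _ => mul_nonneg (by unfold gauge; positivity) ?_
  have h := Complex.re_le_norm (root l ^ m)
  rw [norm_zpow, norm_root, one_zpow] at h
  linarith

theorem conj_mode_neg (m : ℤ) (u : Fin k → ℂ) :
    conj (mode (-m) u) = ∑ i, vertex i ^ (1 - m) * conj (u i) := by
  rw [mode, map_sum]
  refine Finset.sum_congr rfl fun i _ => ?_
  rw [map_mul, map_zpow₀, conj_eq_inv_of_norm_eq_one (norm_vertex i), inv_zpow', neg_neg,
    neg_add_eq_sub]

variable [NeZero k]

theorem gauge_neg (l : Fin k) : gauge α r (-l) = gauge α r l := by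
  have : ‖1 - root (-l)‖ = ‖1 - root l‖ := by
    rw [root_neg, ← conj_eq_inv_of_norm_eq_one (norm_root l), ← Complex.norm_conj (1 - root l)]
    simp
  rw [gauge, gauge, this]

/-- The sum is real because the gauge is invariant under `l ↦ -l`, which conjugates the roots. -/
theorem sum_gauge_mul_eq (m : ℤ) :
    ∑ l : Fin k, (gauge α r l : ℂ) * (1 - root l ^ m) = symbol k α r m := by
  have hc : conj (∑ l : Fin k, (gauge α r l : ℂ) * (1 - root l ^ m)) =
      ∑ l : Fin k, (gauge α r l : ℂ) * (1 - root l ^ m) := by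
    rw [map_sum,
      ← Equiv.sum_comp (Equiv.neg (Fin k)) fun l => (gauge α r l : ℂ) * (1 - root l ^ m)]
    refine Finset.sum_congr rfl fun l _ => ?_
    simp only [Equiv.neg_apply, gauge_neg, map_mul, map_sub, map_one, Complex.conj_ofReal,
      map_zpow₀, root_neg]
    rw [conj_eq_inv_of_norm_eq_one (norm_root l)]
  rw [← Complex.conj_eq_iff_re.1 hc, symbol, Complex.re_sum]
  congr 1
  refine Finset.sum_congr rfl fun l _ => ?_
  simp

theorem symbol_neg (m : ℤ) : symbol k α r (-m) = symbol k α r m := by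
  rw [symbol, symbol, ← Equiv.sum_comp (Equiv.neg (Fin k))]
  refine Finset.sum_congr rfl fun l _ => ?_
  simp only [Equiv.neg_apply, gauge_neg, root_neg, inv_zpow, zpow_neg, inv_inv]

theorem symbol_pos (hr : 0 < r) {m : ℤ} (hm : ¬ (k : ℤ) ∣ m) : 0 < symbol k α r m := by
  have hre : ∀ l : Fin k, (root l ^ m).re ≤ 1 := fun l => by
    have h := Complex.re_le_norm (root l ^ m)
    rwa [norm_zpow, norm_root, one_zpow] at h
  have hz : zeta k ^ m ≠ 1 := fun h => hm (isPrimitiveRoot_zeta.zpow_eq_one_iff_dvd m |>.1 h)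
  have hz1 : root (1 : Fin k) ≠ 1 := fun h => hz (by rw [← root_one, h, one_zpow])
  refine Finset.sum_pos' (fun l _ => mul_nonneg (by unfold gauge; positivity)
    (by linarith [hre l])) ⟨1, Finset.mem_univ _, mul_pos ?_ ?_⟩
  · have := norm_pos_iff.2 (sub_ne_zero.2 hz1.symm)
    unfold gauge; positivity
  · refine sub_pos.2 (lt_of_le_of_ne (hre 1) fun h => hz ?_)
    have hn : ‖zeta k ^ m‖ = 1 := by rw [norm_zpow, norm_zeta, one_zpow]
    rw [root_one] at h
    have him : (zeta k ^ m).im = 0 := by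
      have := Complex.normSq_apply (zeta k ^ m)
      rw [Complex.normSq_eq_norm_sq, hn, h] at this
      nlinarith
    exact Complex.ext (by simpa using h) (by simpa using him)

theorem norm_vertex_sub (hr : 0 < r) (i l : Fin k) :
    ‖(r : ℂ) * vertex i - (r : ℂ) * vertex (i + l)‖ = r * ‖1 - root l‖ := by
  rw [vertex_add, show (r : ℂ) * vertex i - (r : ℂ) * (vertex i * root l) =
    (r : ℂ) * (vertex i * (1 - root l)) by ring, norm_mul, norm_mul, norm_vertex, one_mul,
    Complex.norm_real, Real.norm_of_nonneg hr.le]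

theorem pairOp_vertex (hα : 1 < α) (hr : 0 < r) (i l : Fin k) (x : ℂ) :
    pairOp α ((r : ℂ) * vertex i - (r : ℂ) * vertex (i + l)) x =
      (gauge α r l : ℂ) * ((((α - 1) / 2 : ℝ) : ℂ) * x -
        (((α + 1) / 2 : ℝ) : ℂ) * (vertex i ^ 2 * root l) * conj x) := by
  rw [pairOp, norm_vertex_sub hr, gauge]
  -- At zero separation the power `0 ^ (-(α + 1))` is `0` by convention, so both sides vanish.
  by_cases hl : l = 0
  · subst hl
    rw [root_zero, sub_self, norm_zero, mul_zero, Real.zero_rpow (by linarith)]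
    simp
  have h1 : (1 : ℂ) - root l ≠ 0 := sub_ne_zero.2 fun h => hl (root_eq_one_iff.1 h.symm)
  have hn : ((‖1 - root l‖ : ℝ) : ℂ) ^ 2 = (1 - root l) * (1 - (root l)⁻¹) := by
    rw [← conj_eq_inv_of_norm_eq_one (norm_root l), ← Complex.mul_conj', map_sub, map_one]
  -- With `ρ = root l` of modulus one, `(1 - ρ)² / ‖1 - ρ‖² = (1 - ρ) / (1 - ρ⁻¹) = -ρ`.
  have h2 : ((r : ℂ) * vertex i - (r : ℂ) * vertex (i + l)) ^ 2 /
      (((r * ‖1 - root l‖ : ℝ) : ℂ)) ^ 2 = -(vertex i ^ 2 * root l) := by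
    have hr' : (r : ℂ) ≠ 0 := by exact_mod_cast hr.ne'
    have hne : ((‖1 - root l‖ : ℝ) : ℂ) ^ 2 ≠ 0 :=
      pow_ne_zero 2 (by exact_mod_cast norm_ne_zero_iff.2 h1)
    rw [Complex.ofReal_mul, mul_pow, div_eq_iff (mul_ne_zero (pow_ne_zero 2 hr') hne), hn,
      vertex_add]
    have := root_ne_zero l
    field_simp
    ring
  rw [h2]
  ring

theorem hessianOp_vertex (hα : 1 < α) (hr : 0 < r) (u : Fin k → ℂ) (i : Fin k) :
    hessianOp α (fun j => (r : ℂ) * vertex j) u i =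
      ∑ l, (gauge α r l : ℂ) * ((((α - 1) / 2 : ℝ) : ℂ) * (u i - u (i + l)) -
        (((α + 1) / 2 : ℝ) : ℂ) * (vertex i ^ 2 * root l) * conj (u i - u (i + l))) := by
  rw [hessianOp, ← Equiv.sum_comp (Equiv.addLeft i)]
  exact Finset.sum_congr rfl fun l _ => pairOp_vertex hα hr i l _

theorem sum_vertex_zpow_mul_shift (m : ℤ) (u : Fin k → ℂ) (l : Fin k) :
    ∑ i, vertex i ^ m * u (i + l) = root l ^ (-m) * ∑ i, vertex i ^ m * u i := by
  rw [← Equiv.sum_comp (Equiv.addRight l) fun i => vertex i ^ m * u i, Finset.mul_sum]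
  refine Finset.sum_congr rfl fun i _ => ?_
  have h : root l ^ (-m) * root l ^ m = 1 := by
    rw [← zpow_add₀ (root_ne_zero l), neg_add_cancel, zpow_zero]
  simp only [Equiv.coe_addRight, vertex_add, mul_zpow]
  linear_combination -(vertex i ^ m * u (i + l)) * h

/-- A shift of the bodies multiplies a mode by a power of `root l`, so each part of the operator
acts by a scalar. The conjugate-linear part sends the class `-m` to the class `m`; its scalar comes
from `root l ^ m - root l = (1 - root l) - (1 - root l ^ m)`. -/
theorem mode_hessianOp (hα : 1 < α) (hr : 0 < r) (m : ℤ) (u : Fin k → ℂ) :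
    mode m (hessianOp α (fun j => (r : ℂ) * vertex j) u) =
      (((α - 1) / 2 * symbol k α r (m + 1) : ℝ) : ℂ) * mode m u +
        (((α + 1) / 2 * (symbol k α r 1 - symbol k α r m) : ℝ) : ℂ) * conj (mode (-m) u) := by
  have h1 : mode m (hessianOp α (fun j => (r : ℂ) * vertex j) u) =
      ∑ l, (gauge α r l : ℂ) *
        ((((α - 1) / 2 : ℝ) : ℂ) * ((∑ i, vertex i ^ (-(m + 1)) * u i) -
            ∑ i, vertex i ^ (-(m + 1)) * u (i + l)) -
          (((α + 1) / 2 : ℝ) : ℂ) * root l * ((∑ i, vertex i ^ (1 - m) * conj (u i)) -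
            ∑ i, vertex i ^ (1 - m) * conj (u (i + l)))) := by
    rw [mode]
    simp only [hessianOp_vertex hα hr, Finset.mul_sum]
    rw [Finset.sum_comm]
    refine Finset.sum_congr rfl fun l _ => ?_
    simp only [← Finset.sum_sub_distrib, Finset.mul_sum]
    refine Finset.sum_congr rfl fun i _ => ?_
    have : vertex i ^ (1 - m) = vertex i ^ (-(m + 1)) * vertex i ^ 2 := by
      rw [← zpow_natCast, ← zpow_add₀ (vertex_ne_zero i)]
      congr 1; push_cast; ring
    rw [this, map_sub]
    ring
  rw [h1, conj_mode_neg]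
  simp only [sum_vertex_zpow_mul_shift,
    sum_vertex_zpow_mul_shift (1 - m) fun i => conj (u i), neg_neg, neg_sub]
  rw [← mode]
  generalize mode m u = c
  generalize (∑ i, vertex i ^ (1 - m) * conj (u i)) = d
  push_cast
  rw [← sum_gauge_mul_eq, ← sum_gauge_mul_eq, ← sum_gauge_mul_eq, ← Finset.sum_sub_distrib,
    Finset.mul_sum, Finset.mul_sum, Finset.sum_mul, Finset.sum_mul, ← Finset.sum_add_distrib]
  refine Finset.sum_congr rfl fun l _ => ?_
  have : root l ^ m = root l * root l ^ (m - 1) := by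
    rw [← zpow_one_add₀ (root_ne_zero l)]; congr 1; ring
  rw [this, zpow_one]
  ring

/-- The polygon thus solves the central configuration equation as soon as its symbol at `1` equals
`1`, which fixes the radius. -/
theorem sum_gauge_vertex (hr : 0 < r) (i : Fin k) :
    ∑ j : Fin k, ((‖(r : ℂ) * vertex i - (r : ℂ) * vertex j‖ ^ (-(α + 1)) : ℝ) : ℂ) *
        ((r : ℂ) * vertex i - (r : ℂ) * vertex j) =
      symbol k α r 1 * ((r : ℂ) * vertex i) := by
  rw [← Equiv.sum_comp (Equiv.addLeft i), ← sum_gauge_mul_eq, Finset.sum_mul]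
  refine Finset.sum_congr rfl fun l _ => ?_
  rw [Equiv.coe_addLeft, norm_vertex_sub hr, vertex_add, ← gauge, zpow_one]
  ring

theorem mode_inversion (u : Fin k → ℂ) (j : Fin k) :
    ∑ m ∈ Finset.range k, vertex j ^ (m + 1) * mode (m : ℤ) u = k * u j := by
  simp only [mode, Finset.mul_sum]
  rw [Finset.sum_comm, Finset.sum_eq_single j]
  · have : ∀ m ∈ Finset.range k,
        vertex j ^ (m + 1) * (vertex j ^ (-((m : ℤ) + 1)) * u j) = u j := by
      intro m _
      rw [← mul_assoc, ← zpow_natCast, ← zpow_add₀ (vertex_ne_zero j)]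
      simp
    rw [Finset.sum_congr rfl this]
    simp
  · intro i _ hij
    have h : ∀ m : ℕ, vertex j ^ (m + 1) * (vertex i ^ (-((m : ℤ) + 1)) * u i) =
        root (j - i) * u i * root (j - i) ^ m := by
      intro m
      have hv : vertex j = vertex i * root (j - i) := by rw [← vertex_add, add_sub_cancel]
      have hi : vertex i ^ (m + 1) * vertex i ^ (-((m : ℤ) + 1)) = 1 := by
        rw [← zpow_natCast, ← zpow_add₀ (vertex_ne_zero i)]
        simp
      rw [hv, mul_pow]
      linear_combination root (j - i) ^ (m + 1) * u i * hi
    simp only [h]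
    rw [← Finset.mul_sum, sum_root_pow_eq_zero (sub_ne_zero.2 hij.symm), mul_zero]
  · simp

end Modes

/-! ### Normalisation of the circumradius -/

section Normalisation

variable {k : ℕ}

theorem norm_one_sub_root (l : Fin k) :
    ‖1 - root l‖ = 2 * Real.sin ((l : ℕ) * (2 * π / k) / 2) := by
  have h1 : root l = Complex.exp (Complex.I * (((l : ℕ) * (2 * π / k) : ℝ) : ℂ)) := by
    rw [root, zeta, ← Complex.exp_nat_mul]
    congr 1; push_cast; ring
  rw [norm_sub_rev, h1, Complex.norm_exp_I_mul_ofReal_sub_one, Real.norm_of_nonneg]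
  have hk : (0 : ℝ) < k := by exact_mod_cast l.pos
  have hl : ((l : ℕ) : ℝ) ≤ k := by exact_mod_cast l.isLt.le
  refine mul_nonneg zero_le_two (Real.sin_nonneg_of_nonneg_of_le_pi (by positivity) ?_)
  have : ((l : ℕ) : ℝ) * (2 * π / k) / 2 = (l : ℕ) / k * π := by field_simp
  rw [this]
  exact mul_le_of_le_one_left pi_pos.le ((div_le_one hk).2 hl)

theorem one_sub_re_eq (z : ℂ) (hz : ‖z‖ = 1) : 1 - z.re = ‖1 - z‖ ^ 2 / 2 := by
  have h := norm_sub_sq_real (1 : ℂ) z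
  rw [hz, norm_one] at h
  have h2 : ⟪(1 : ℂ), z⟫_ℝ = z.re := by simp [Complex.inner]
  rw [h, h2]; ring

theorem sin_pos_of_mem_Ico {l : ℕ} (hl : l ∈ Finset.Ico 1 k) :
    0 < Real.sin (l * (2 * π / k) / 2) := by
  have h := Finset.mem_Ico.1 hl
  have hl0 : (0 : ℝ) < l := by exact_mod_cast h.1
  have hlk : (l : ℝ) < k := by exact_mod_cast h.2
  have hk : (0 : ℝ) < k := hl0.trans hlk
  refine Real.sin_pos_of_pos_of_lt_pi (by positivity) ?_
  rw [show (l : ℝ) * (2 * π / k) / 2 = l / k * π by field_simp]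
  exact mul_lt_of_lt_one_left pi_pos ((div_lt_one hk).2 hlk)

theorem sOne_pos (hk : 2 ≤ k) (α : ℝ) : 0 < sOne k α := by
  refine mul_pos (by positivity) (Finset.sum_pos (fun l hl => ?_) ⟨1, by simp; omega⟩)
  have := sin_pos_of_mem_Ico hl
  positivity

/-- Termwise, `(2 r sin)^(-(α+1)) (2 sin)² / 2 = r^(-(α+1)) 2^(-α) sin^(1-α)`; the term `l = 0`
vanishes. -/
theorem symbol_one_eq [NeZero k] {α r : ℝ} (hr : 0 < r) :
    symbol k α r 1 = r ^ (-(α + 1)) * sOne k α := by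
  obtain ⟨F, hF⟩ : ∃ F : ℕ → ℝ, ∀ l : ℕ, F l =
      (r * (2 * Real.sin (l * (2 * π / k) / 2))) ^ (-(α + 1)) *
        ((2 * Real.sin (l * (2 * π / k) / 2)) ^ 2 / 2) := ⟨fun l => _, fun l => rfl⟩
  have h0 : symbol k α r 1 = ∑ l : Fin k, F l := by
    refine Finset.sum_congr rfl fun l _ => ?_
    rw [hF, gauge, zpow_one, one_sub_re_eq _ (norm_root l), norm_one_sub_root]
  rw [h0, ← Finset.sum_range, Finset.range_eq_Ico, Finset.sum_eq_sum_Ico_succ_bot (NeZero.pos k),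
    sOne, Finset.mul_sum, Finset.mul_sum]
  simp only [hF, Nat.cast_zero, zero_mul, zero_div, Real.sin_zero, mul_zero, ne_eq,
    OfNat.ofNat_ne_zero, not_false_eq_true, zero_pow, zero_add]
  refine Finset.sum_congr rfl fun l hl => ?_
  have hs := sin_pos_of_mem_Ico hl
  generalize Real.sin (l * (2 * π / k) / 2) = x at hs
  rw [Real.mul_rpow hr.le (by positivity), Real.mul_rpow zero_le_two hs.le,
    show -(α + 1) = -α - 1 by ring, Real.rpow_sub_one two_ne_zero, Real.rpow_neg zero_le_two,
    show -α - 1 = -(α - 1) - 2 by ring, Real.rpow_sub hs, Real.rpow_neg hs.le, Real.rpow_two]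
  field_simp

theorem symbol_one_polygon [NeZero k] (hk : 2 ≤ k) {α : ℝ} (hα : 0 < α) :
    symbol k α (sOne k α ^ (1 / (α + 1))) 1 = 1 := by
  have hs := sOne_pos hk α
  rw [symbol_one_eq (Real.rpow_pos_of_pos hs _), ← Real.rpow_mul hs.le,
    show 1 / (α + 1) * -(α + 1) = -1 by field_simp, Real.rpow_neg_one, inv_mul_cancel₀ hs.ne']

end Normalisation

/-! ### Fourier coefficients of loops and the kernel of the Hessian -/

/-- The Fourier coefficient of a loop with discrete mode `m` and frequency `n`. -/
def loopCoeff {k : ℕ} (m n : ℤ) (u : ℝ → Fin k → ℂ) : ℂ :=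
  ∫ s in (0 : ℝ)..(2 * π), Complex.exp (Complex.I * (-n : ℤ) * s) * mode m (u s)

/-- The determinant of the Hessian on the modes `(m, n)` and `(-m, -n)`, where `ν = n / p`. -/
def modeDet (k : ℕ) (α r : ℝ) (m : ℤ) (ν : ℝ) : ℝ :=
  ((1 + ν) ^ 2 + (α - 1) / 2 * symbol k α r (m + 1)) *
      ((1 - ν) ^ 2 + (α - 1) / 2 * symbol k α r (m - 1)) -
    ((α + 1) / 2 * (1 - symbol k α r m)) ^ 2

/-- The loop of frequency `n` in the discrete mode `m`. -/
def testLoop {k : ℕ} (m n : ℤ) (c : ℂ) (s : ℝ) (j : Fin k) : ℂ :=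
  c * vertex j ^ (m + 1) * Complex.exp (Complex.I * n * s)

section LoopModes

variable {k : ℕ}

theorem conj_cexp_int (n : ℤ) (s : ℝ) :
    conj (Complex.exp (Complex.I * n * s)) = Complex.exp (Complex.I * (-n : ℤ) * s) := by
  rw [← Complex.exp_conj]
  congr 1
  simp

theorem hasDerivAt_testLoop (m n : ℤ) (c : ℂ) (s : ℝ) :
    HasDerivAt (testLoop (k := k) m n c) (fun j => Complex.I * n * testLoop m n c s j) s := by
  refine hasDerivAt_pi.2 fun j => ?_
  refine ((hasDerivAt_cexp_int n s).const_mul (c * vertex j ^ (m + 1))).congr_deriv ?_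
  rw [testLoop]; ring

theorem velocity_testLoop (m n p : ℤ) (c : ℂ) (s : ℝ) (j : Fin k) :
    velocity p (testLoop m n c) s j =
      Complex.I * (1 + ((n / p : ℝ) : ℂ)) * testLoop m n c s j := by
  rw [velocity, (hasDerivAt_testLoop m n c s).deriv]
  push_cast
  ring

/-- The divisibility condition excludes the class of the centre of mass. -/
theorem testLoop_mem_loopSpace [NeZero k] {m : ℤ} (hm : ¬ (k : ℤ) ∣ m + 1) (n : ℤ) (c : ℂ) :
    testLoop m n c ∈ loopSpace fun _ : Fin k => (1 : ℝ) := by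
  refine mem_loopSpace_of_contDiff ?_ ?_ ?_
  · exact contDiff_pi.2 fun j => contDiff_const.mul (contDiff_cexp_int n)
  · intro s
    funext j
    have : Complex.I * n * ((s + 2 * π : ℝ) : ℂ) =
        Complex.I * n * s + Complex.I * n * ((2 * π : ℝ) : ℂ) := by push_cast; ring
    rw [testLoop, testLoop, this, Complex.exp_add, cexp_int_two_pi, mul_one]
  · intro s
    simp only [testLoop, Complex.ofReal_one, one_mul]
    rw [← Finset.sum_mul, ← Finset.mul_sum, sum_vertex_zpow_eq_zero hm]
    ring

theorem intervalIntegrable_cexp_mul {f : ℝ → ℂ} (n : ℤ) (hf : ContinuousOn f (Icc 0 (2 * π))) :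
    IntervalIntegrable (fun s : ℝ => Complex.exp (Complex.I * n * s) * f s) volume 0 (2 * π) := by
  refine ContinuousOn.intervalIntegrable ?_
  rw [uIcc_of_le two_pi_pos.le]
  exact (contDiff_cexp_int n).continuous.continuousOn.mul hf

theorem continuousOn_mode {f : ℝ → Fin k → ℂ} {b : ℝ}
    (hf : ∀ j, ContinuousOn (fun s => f s j) (Icc 0 b)) (m : ℤ) :
    ContinuousOn (fun s => mode m (f s)) (Icc 0 b) :=
  continuousOn_finsetSum _ fun j _ => continuousOn_const.mul (hf j)

theorem loopCoeff_eq_sum {f : ℝ → Fin k → ℂ}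
    (hf : ∀ j, ContinuousOn (fun s => f s j) (Icc 0 (2 * π))) (m n : ℤ) :
    loopCoeff m n f = ∑ j, vertex j ^ (-(m + 1)) *
      ∫ s in (0 : ℝ)..(2 * π), Complex.exp (Complex.I * (-n : ℤ) * s) * f s j := by
  simp only [loopCoeff, mode, Finset.mul_sum, ← intervalIntegral.integral_const_mul]
  rw [← intervalIntegral.integral_finsetSum
    fun j _ => (intervalIntegrable_cexp_mul (-n) (hf j)).const_mul _]
  refine intervalIntegral.integral_congr fun s _ => Finset.sum_congr rfl fun j _ => ?_
  ring

theorem conj_loopCoeff_neg (m n : ℤ) (u : ℝ → Fin k → ℂ) :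
    conj (loopCoeff m (-n) u) = ∫ s in (0 : ℝ)..(2 * π),
      Complex.exp (Complex.I * (-n : ℤ) * s) * conj (mode m (u s)) := by
  rw [loopCoeff, intervalIntegral.intervalIntegral_eq_integral_uIoc,
    intervalIntegral.intervalIntegral_eq_integral_uIoc, Complex.real_smul, Complex.real_smul,
    map_mul, Complex.conj_ofReal, ← integral_conj]
  simp only [map_mul, conj_cexp_int, neg_neg]

theorem loopCoeff_neg_one {u : ℝ → Fin k → ℂ} (hu : u ∈ loopSpace fun _ : Fin k => (1 : ℝ))
    (n : ℤ) : loopCoeff (-1) n u = 0 := by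
  have : ∀ s, mode (-1) (u s) = 0 := fun s => by simpa [mode] using hu.2.2.2 s
  simp [loopCoeff, this]

/-- On `J z` the pair operator is `-J` times the pair force, hence the Hessian of `U` sends `J a` to
`-J a`. This cancels the kinetic contribution, up to a derivative that integrates to zero. -/
theorem hessian_rotation_eq_zero {α : ℝ} {a : Fin k → ℂ} (hα : 1 < α)
    (ha : Function.Injective a) (hcent : ∑ j, a j = 0)
    (hcc : ∀ i, ∑ j, ((‖a i - a j‖ ^ (-(α + 1)) : ℝ) : ℂ) * (a i - a j) = a i) (p : ℤ) (t : ℝ) :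
    (fun _ => t • Complex.I • a) ∈ loopSpace (fun _ : Fin k => (1 : ℝ)) ∧
    ∀ v ∈ loopSpace fun _ : Fin k => (1 : ℝ),
      hessian (action α (fun _ => 1) p) (fun _ => a) (fun _ => t • Complex.I • a) v = 0 := by
  have hmem : (fun _ => t • Complex.I • a) ∈ loopSpace (fun _ : Fin k => (1 : ℝ)) := by
    refine const_mem_loopSpace ?_
    simp only [Pi.smul_apply, Complex.ofReal_one, one_mul, ← Finset.smul_sum, hcent, smul_zero]
  refine ⟨hmem, fun v hv => ?_⟩
  have hop : ∀ i, hessianOp α a (t • Complex.I • a) i = -(t * Complex.I * a i) := by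
    intro i
    rw [hessianOp]
    have : ∀ j, pairOp α (a i - a j) ((t • Complex.I • a) i - (t • Complex.I • a) j) =
        -(t * Complex.I) * (((‖a i - a j‖ ^ (-(α + 1)) : ℝ) : ℂ) * (a i - a j)) := by
      intro j
      have hx : (t • Complex.I • a) i - (t • Complex.I • a) j =
          t * Complex.I * (a i - a j) := by
        simp only [Pi.smul_apply, smul_eq_mul, Complex.real_smul]; ring
      rw [hx]
      by_cases hz : a i - a j = 0
      · simp [hz, pairOp]
      · generalize a i - a j = z at hz
        have hn : ((‖z‖ : ℝ) : ℂ) ^ 2 ≠ 0 :=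
          pow_ne_zero 2 (by exact_mod_cast norm_ne_zero_iff.2 hz)
        have hzz : z ^ 2 / ((‖z‖ : ℝ) : ℂ) ^ 2 * conj z = z := by
          rw [div_mul_eq_mul_div, div_eq_iff hn, ← Complex.mul_conj']
          ring
        rw [pairOp, map_mul, map_mul, Complex.conj_ofReal, Complex.conj_I]
        push_cast
        linear_combination (-(((‖z‖ ^ (-(α + 1)) : ℝ) : ℂ)) * ((α + 1) / 2 * t * Complex.I)) * hzz
    simp only [this]
    rw [← Finset.mul_sum, hcc]
    ring
  rw [hessian_action_eq hα ha hmem hv, ← Finset.sum_add_distrib, Finset.sum_eq_zero,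
    Complex.zero_re]
  intro j _
  have hcv := continuousOn_of_mem_loopSpace hv j
  have hci : IntervalIntegrable (fun s => conj (v s j)) volume 0 (2 * π) := by
    refine ContinuousOn.intervalIntegrable ?_
    rw [uIcc_of_le two_pi_pos.le]
    exact Complex.continuous_conj.comp_continuousOn hcv
  have hd : ∫ s in (0 : ℝ)..(2 * π), conj (deriv v s j) = 0 := by
    have := (Complex.conjCLE : ℂ →L[ℝ] ℂ).intervalIntegral_comp_comm
      (intervalIntegrable_deriv_apply hv j)
    rw [integral_deriv_apply_eq_zero hv j, map_zero] at this
    exact this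
  have hdi : IntervalIntegrable (fun s => conj (deriv v s j)) volume 0 (2 * π) := by
    rw [intervalIntegrable_iff_integrableOn_Ioc_of_le two_pi_pos.le]
    exact (Complex.conjCLE : ℂ →L[ℝ] ℂ).integrable_comp
      ((memLp_deriv_apply hv j).integrable (by norm_num))
  have hvel : ∀ s, conj (velocity p v s j) * velocity p (fun _ => t • Complex.I • a) s j =
      (-(t * a j) * ((1 / p : ℝ) : ℂ)) * conj (deriv v s j) +
        (t * Complex.I * a j) * conj (v s j) := by
    intro s
    rw [velocity, velocity, deriv_const]
    simp only [map_add, map_mul, Complex.conj_ofReal, Complex.conj_I, Pi.zero_apply, mul_zero,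
      zero_add, Pi.smul_apply, smul_eq_mul, Complex.real_smul]
    linear_combination (conj (deriv v s j) * ((1 / p : ℝ) : ℂ) * t * a j -
      Complex.I * conj (v s j) * t * a j) * Complex.I_mul_I
  simp only [hvel, hop]
  rw [intervalIntegral.integral_add (hdi.const_mul _) (hci.const_mul _),
    intervalIntegral.integral_const_mul, intervalIntegral.integral_const_mul,
    intervalIntegral.integral_mul_const, hd]
  ring

/-! ### The second variation tested on single Fourier modes -/

variable [NeZero k] {α r : ℝ}

theorem hessian_testLoop (hα : 1 < α) (hr : 0 < r) (hS : symbol k α r 1 = 1) (p : ℤ)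
    {u : ℝ → Fin k → ℂ} (hu : u ∈ loopSpace fun _ : Fin k => (1 : ℝ)) {m : ℤ}
    (hm : ¬ (k : ℤ) ∣ m + 1) (n : ℤ) (c : ℂ) :
    hessian (action α (fun _ => 1) p) (fun _ j => (r : ℂ) * vertex j) u (testLoop m n c) =
      (conj c * ((((1 + n / p) ^ 2 + (α - 1) / 2 * symbol k α r (m + 1) : ℝ) : ℂ) *
          loopCoeff m n u +
        (((α + 1) / 2 * (1 - symbol k α r m) : ℝ) : ℂ) * conj (loopCoeff (-m) (-n) u))).re := by
  have ha : Function.Injective fun j : Fin k => (r : ℂ) * vertex j := fun i j h =>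
    vertex_injective (mul_left_cancel₀ (by exact_mod_cast hr.ne') h)
  have hcu := fun j => continuousOn_of_mem_loopSpace hu j
  rw [hessian_action_eq hα ha hu (testLoop_mem_loopSpace hm n c)]
  congr 1
  have hconj : ∀ (s : ℝ) (j : Fin k), conj (testLoop m n c s j) =
      conj c * vertex j ^ (-(m + 1)) * Complex.exp (Complex.I * (-n : ℤ) * s) := by
    intro s j
    rw [testLoop, map_mul, map_mul, map_zpow₀, conj_eq_inv_of_norm_eq_one (norm_vertex j),
      inv_zpow', conj_cexp_int]
  -- The covariant derivative has symbol `I (1 + ν)` on frequency `n`; after integration by parts it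
  -- occurs once for each argument, giving `(1 + ν)²`.
  have hkin : ∀ j, ∫ s in (0 : ℝ)..(2 * π),
      conj (velocity p (testLoop m n c) s j) * velocity p u s j =
      conj c * (((1 + n / p) ^ 2 : ℝ) : ℂ) * (vertex j ^ (-(m + 1)) *
        ∫ s in (0 : ℝ)..(2 * π), Complex.exp (Complex.I * (-n : ℤ) * s) * u s j) := by
    intro j
    have h1 : ∀ s : ℝ, conj (velocity p (testLoop m n c) s j) * velocity p u s j =
        (-Complex.I * (1 + ((n / p : ℝ) : ℂ)) * conj c * vertex j ^ (-(m + 1))) *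
          (((1 / p : ℝ) : ℂ) * (Complex.exp (Complex.I * (-n : ℤ) * s) * deriv u s j) +
            Complex.I * (Complex.exp (Complex.I * (-n : ℤ) * s) * u s j)) := by
      intro s
      rw [velocity_testLoop, map_mul, hconj, map_mul, map_add, map_one, Complex.conj_ofReal,
        Complex.conj_I, velocity]
      ring
    simp only [h1]
    rw [intervalIntegral.integral_const_mul, intervalIntegral.integral_add
      (((intervalIntegrable_deriv_apply hu j).continuousOn_mul
        (contDiff_cexp_int (-n)).continuous.continuousOn).const_mul _)
      ((intervalIntegrable_cexp_mul (-n) (hcu j)).const_mul _),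
      intervalIntegral.integral_const_mul, intervalIntegral.integral_const_mul,
      integral_cexp_mul_deriv_apply hu]
    generalize (∫ s in (0 : ℝ)..(2 * π), Complex.exp (Complex.I * (-n : ℤ) * s) * u s j) = Y
    push_cast
    linear_combination (-(1 + (n / p : ℂ)) ^ 2 * conj c * vertex j ^ (-(m + 1)) * Y) *
      Complex.I_mul_I
  have hpot : ∑ j, ∫ s in (0 : ℝ)..(2 * π), conj (testLoop m n c s j) *
        hessianOp α (fun j => (r : ℂ) * vertex j) (u s) j =
      conj c * loopCoeff m n fun s => hessianOp α (fun j => (r : ℂ) * vertex j) (u s) := by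
    rw [loopCoeff_eq_sum fun j => continuousOn_hessianOp hu j, Finset.mul_sum]
    refine Finset.sum_congr rfl fun j _ => ?_
    simp only [hconj, ← intervalIntegral.integral_const_mul]
    refine intervalIntegral.integral_congr fun s _ => ?_
    ring
  have hmode : loopCoeff m n (fun s => hessianOp α (fun j => (r : ℂ) * vertex j) (u s)) =
      (((α - 1) / 2 * symbol k α r (m + 1) : ℝ) : ℂ) * loopCoeff m n u +
        (((α + 1) / 2 * (1 - symbol k α r m) : ℝ) : ℂ) * conj (loopCoeff (-m) (-n) u) := by
    rw [conj_loopCoeff_neg, loopCoeff, loopCoeff, ← intervalIntegral.integral_const_mul,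
      ← intervalIntegral.integral_const_mul, ← intervalIntegral.integral_add]
    · refine intervalIntegral.integral_congr fun s _ => ?_
      simp only [mode_hessianOp hα hr, hS]
      ring
    · exact (intervalIntegrable_cexp_mul (-n) (continuousOn_mode hcu m)).const_mul _
    · exact (intervalIntegrable_cexp_mul (-n) (Complex.continuous_conj.comp_continuousOn
        (continuousOn_mode hcu (-m)))).const_mul _
  rw [Finset.sum_congr rfl fun j _ => hkin j, ← Finset.mul_sum, ← loopCoeff_eq_sum hcu, hpot,
    hmode]
  push_cast
  ring

theorem loopCoeff_equation (hα : 1 < α) (hr : 0 < r) (hS : symbol k α r 1 = 1) {p : ℤ}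
    {u : ℝ → Fin k → ℂ} (hu : u ∈ loopSpace fun _ : Fin k => (1 : ℝ))
    (hker : ∀ v ∈ loopSpace fun _ : Fin k => (1 : ℝ),
      hessian (action α (fun _ => 1) p) (fun _ j => (r : ℂ) * vertex j) u v = 0) {m : ℤ}
    (hm : ¬ (k : ℤ) ∣ m + 1) (n : ℤ) :
    (((1 + n / p) ^ 2 + (α - 1) / 2 * symbol k α r (m + 1) : ℝ) : ℂ) * loopCoeff m n u +
      (((α + 1) / 2 * (1 - symbol k α r m) : ℝ) : ℂ) * conj (loopCoeff (-m) (-n) u) = 0 := by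
  have h := fun c => (hessian_testLoop hα hr hS p hu hm n c).symm.trans
    (hker _ (testLoop_mem_loopSpace hm n c))
  -- The amplitudes `1` and `I` give the real and the imaginary part of the equation.
  have h1 := h 1
  have h2 := h Complex.I
  rw [map_one, one_mul] at h1
  rw [Complex.conj_I, neg_mul, Complex.neg_re, Complex.I_mul_re, neg_neg] at h2
  exact Complex.ext h1 h2

theorem not_dvd_of_lt {k : ℕ} {m : ℤ} (h0 : 0 < m) (hk : m < k) : ¬ (k : ℤ) ∣ m := fun h =>
  absurd (Int.le_of_dvd h0 h) (not_le.2 hk)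

/-- The equation at `(m, n)` and the conjugate of the one at `(-m, -n)` form a linear system in the
two coupled coefficients; Cramer's rule applies when both classes differ from the centre of mass. -/
theorem loopCoeff_eq_zero_of_modeDet (hα : 1 < α) (hr : 0 < r) (hS : symbol k α r 1 = 1) {p : ℤ}
    {u : ℝ → Fin k → ℂ} (hu : u ∈ loopSpace fun _ : Fin k => (1 : ℝ))
    (hker : ∀ v ∈ loopSpace fun _ : Fin k => (1 : ℝ),
      hessian (action α (fun _ => 1) p) (fun _ j => (r : ℂ) * vertex j) u v = 0) {m : ℤ}
    (hm : ¬ (k : ℤ) ∣ m + 1) (hm' : ¬ (k : ℤ) ∣ -m + 1) {n : ℤ}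
    (hdet : modeDet k α r m (n / p) ≠ 0) : loopCoeff m n u = 0 := by
  have h1 := loopCoeff_equation hα hr hS hu hker hm n
  have h2 := congrArg conj (loopCoeff_equation hα hr hS hu hker hm' (-n))
  rw [neg_neg, neg_neg, symbol_neg, show -m + 1 = -(m - 1) by ring, symbol_neg, map_add, map_mul,
    map_mul, Complex.conj_ofReal, Complex.conj_ofReal, Complex.conj_conj, map_zero] at h2
  generalize conj (loopCoeff (-m) (-n) u) = d at h1 h2
  have h3 : ((modeDet k α r m (n / p) : ℝ) : ℂ) * loopCoeff m n u = 0 := by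
    rw [modeDet]
    push_cast at h1 h2 ⊢
    linear_combination ((1 - (n / p : ℂ)) ^ 2 + ((α : ℂ) - 1) / 2 * symbol k α r (m - 1)) * h1 -
      (((α : ℂ) + 1) / 2 * (1 - symbol k α r m)) * h2
  exact (mul_eq_zero.1 h3).resolve_left (by exact_mod_cast hdet)

theorem modeDet_zero (hS : symbol k α r 1 = 1) (ν : ℝ) :
    modeDet k α r 0 ν = ν ^ 2 * (ν ^ 2 - (3 - α)) := by
  rw [modeDet, zero_add, zero_sub, symbol_neg, hS, symbol_zero]
  ring

theorem loopCoeff_eq_zero (hk : 3 ≤ k) (hα : 1 < α) (hr : 0 < r) (hS : symbol k α r 1 = 1)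
    {p : ℤ} (hp : p ≠ 0)
    (hdet : ∀ m : ℕ, 2 ≤ m → m + 2 ≤ k → ∀ n : ℤ, modeDet k α r m (n / p) ≠ 0)
    (hdet0 : ∀ n : ℤ, ((n : ℝ) / p) ^ 2 ≠ 3 - α)
    {u : ℝ → Fin k → ℂ} (hu : u ∈ loopSpace fun _ : Fin k => (1 : ℝ))
    (hker : ∀ v ∈ loopSpace fun _ : Fin k => (1 : ℝ),
      hessian (action α (fun _ => 1) p) (fun _ j => (r : ℂ) * vertex j) u v = 0) {m : ℕ}
    (hm : m < k) {n : ℤ} (hmn : m ≠ 0 ∨ n ≠ 0) : loopCoeff m n u = 0 := by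
  have hpR : (p : ℝ) ≠ 0 := by exact_mod_cast hp
  have hdvd : ∀ x : ℤ, 0 < -x → -x < k → ¬ (k : ℤ) ∣ x := fun x h1 h2 h =>
    not_dvd_of_lt h1 h2 ((dvd_neg).2 h)
  rcases Nat.eq_zero_or_pos m with rfl | hm0
  · have hn : n ≠ 0 := hmn.resolve_left (by simp)
    refine loopCoeff_eq_zero_of_modeDet hα hr hS hu hker (not_dvd_of_lt (by simp) ?_)
      (not_dvd_of_lt (by simp) ?_) ?_
    · simp; omega
    · simp; omega
    · rw [Nat.cast_zero, modeDet_zero hS]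
      exact mul_ne_zero (pow_ne_zero 2 (div_ne_zero (by exact_mod_cast hn) hpR))
        (sub_ne_zero.2 (hdet0 n))
  -- The partner of `m = 1` is the centre of mass, which vanishes, so one scalar equation with
  -- positive coefficient remains.
  by_cases hm1 : m = 1
  · subst hm1
    have h := loopCoeff_equation hα hr hS hu hker (m := 1)
      (not_dvd_of_lt (by norm_num) (by omega)) n
    rw [loopCoeff_neg_one hu, map_zero, mul_zero, add_zero] at h
    refine (mul_eq_zero.1 h).resolve_left ?_
    have h2 : 0 < symbol k α r (1 + 1) :=
      symbol_pos hr (not_dvd_of_lt (by norm_num) (by omega))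
    have h3 : 0 < α - 1 := by linarith
    exact_mod_cast (by positivity : 0 < (1 + (n : ℝ) / p) ^ 2 +
      (α - 1) / 2 * symbol k α r (1 + 1)).ne'
  by_cases hmk : m + 1 = k
  -- The class `k - 1 ≡ -1` is again the centre of mass.
  · have : ∀ s, mode (m : ℤ) (u s) = 0 := fun s => by
      have h := hu.2.2.2 s
      have hv : ∀ j : Fin k, vertex j ^ (-((m : ℤ) + 1)) = 1 := fun j => by
        rw [zpow_neg, show ((m : ℤ) + 1) = (k : ℤ) by omega, zpow_natCast, vertex_pow_card,
          inv_one]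
      simpa only [mode, hv, one_mul, Complex.ofReal_one] using h
    simp [loopCoeff, this]
  · exact loopCoeff_eq_zero_of_modeDet hα hr hS hu hker (not_dvd_of_lt (by omega) (by omega))
      (hdvd _ (by omega) (by omega)) (hdet m (by omega) (by omega) n)

theorem integral_cexp_int_eq_zero {n : ℤ} (hn : n ≠ 0) :
    ∫ s in (0 : ℝ)..(2 * π), Complex.exp (Complex.I * n * s) = 0 := by
  have h := integral_cexp_mul_deriv (f := fun _ => 1) n
    (contDiff_const.contDiffOn.absolutelyContinuousOnInterval) (by simp) rfl
  simp only [deriv_const, mul_zero, intervalIntegral.integral_zero, mul_one] at h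
  refine (mul_eq_zero.1 h.symm).resolve_left ?_
  simpa using hn

/-- Only the coefficient `(0, 0)` survives, so Fourier inversion in the bodies and in time makes the
loop a constant complex multiple of the polygon; a purely imaginary multiple is a multiple of `J a`.
-/
theorem exists_smul_eq_of_loopCoeff_eq_zero (hr : 0 < r)
    {u : ℝ → Fin k → ℂ} (hu : u ∈ loopSpace fun _ : Fin k => (1 : ℝ))
    (h : ∀ m : ℕ, m < k → ∀ n : ℤ, (m ≠ 0 ∨ n ≠ 0) → loopCoeff m n u = 0)
    (h0 : (loopCoeff 0 0 u).re = 0) :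
    ∃ t : ℝ, t • (fun _ : ℝ => Complex.I • fun j : Fin k => (r : ℂ) * vertex j) = u := by
  have hcu := fun j => continuousOn_of_mem_loopSpace hu j
  have hkC : (k : ℂ) ≠ 0 := by exact_mod_cast NeZero.ne k
  have hpiC : (π : ℂ) ≠ 0 := by exact_mod_cast pi_ne_zero
  have hinv : ∀ (n : ℤ) (j : Fin k), (k : ℂ) *
      (∫ s in (0 : ℝ)..(2 * π), Complex.exp (Complex.I * (-n : ℤ) * s) * u s j) =
      vertex j * loopCoeff 0 n u := by
    intro n j
    have h1 := mode_inversion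
      (fun j => ∫ s in (0 : ℝ)..(2 * π), Complex.exp (Complex.I * (-n : ℤ) * s) * u s j) j
    rw [← h1, Finset.sum_eq_single 0]
    · rw [loopCoeff_eq_sum hcu]; simp [mode]
    · intro m hm hm0
      have := h m (Finset.mem_range.1 hm) n (Or.inl hm0)
      rw [loopCoeff_eq_sum hcu] at this
      rw [mode, this, mul_zero]
    · exact fun hk0 => absurd (Finset.mem_range.2 (NeZero.pos k)) hk0
  have hval : ∀ (s : ℝ) (j : Fin k), u s j = vertex j * loopCoeff 0 0 u / (2 * π * k) := by
    intro s j
    refine sub_eq_zero.1 (eq_zero_of_fourier_integral_eq_zero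
      (f := fun s => u s j - vertex j * loopCoeff 0 0 u / (2 * π * k))
      ((hcu j).sub continuousOn_const) (fun s => by simp only [hu.1 s]) (fun n => ?_) s)
    simp only [mul_sub]
    rw [intervalIntegral.integral_sub (intervalIntegrable_cexp_mul n (hcu j))
      (intervalIntegrable_cexp_mul n continuousOn_const), intervalIntegral.integral_mul_const]
    by_cases hn : n = 0
    · subst hn
      have := hinv 0 j
      rw [neg_zero] at this
      refine mul_left_cancel₀ hkC ?_
      rw [mul_sub, this]
      simp
      field_simp
      ring
    · have := hinv (-n) j
      rw [neg_neg, show (0 : ℤ) = ((0 : ℕ) : ℤ) from rfl,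
        h 0 (NeZero.pos k) (-n) (Or.inr (neg_ne_zero.2 hn)), mul_zero] at this
      rw [(mul_eq_zero.1 this).resolve_left hkC, integral_cexp_int_eq_zero hn]
      simp
  refine ⟨(loopCoeff 0 0 u).im / (2 * π * k * r), ?_⟩
  funext s j
  rw [hval s j]
  have hC : loopCoeff 0 0 u = Complex.I * ((loopCoeff 0 0 u).im : ℂ) := by
    apply Complex.ext <;> simp [h0]
  have hrC : (r : ℂ) ≠ 0 := by exact_mod_cast hr.ne'
  conv_rhs => rw [hC]
  simp only [Pi.smul_apply, smul_eq_mul, Complex.real_smul]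
  push_cast
  field_simp

theorem isNondegenerate_vertex (hk : 3 ≤ k) (hα : 1 < α) (hr : 0 < r)
    (hS : symbol k α r 1 = 1) {p : ℤ} (hp : p ≠ 0)
    (hdet : ∀ m : ℕ, 2 ≤ m → m + 2 ≤ k → ∀ n : ℤ, modeDet k α r m (n / p) ≠ 0)
    (hdet0 : ∀ n : ℤ, ((n : ℝ) / p) ^ 2 ≠ 3 - α) :
    IsNondegenerate α (fun _ : Fin k => (1 : ℝ)) p fun j => (r : ℂ) * vertex j := by
  have ha : Function.Injective fun j : Fin k => (r : ℂ) * vertex j := fun i j h =>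
    vertex_injective (mul_left_cancel₀ (by exact_mod_cast hr.ne') h)
  have hcent : ∑ j : Fin k, (r : ℂ) * vertex j = 0 := by
    have := sum_vertex_zpow_eq_zero (k := k) (m := 1) (not_dvd_of_lt one_pos (by omega))
    simp only [zpow_one] at this
    rw [← Finset.mul_sum, this, mul_zero]
  have hcc : ∀ i : Fin k, ∑ j : Fin k,
      ((‖(r : ℂ) * vertex i - (r : ℂ) * vertex j‖ ^ (-(α + 1)) : ℝ) : ℂ) *
        ((r : ℂ) * vertex i - (r : ℂ) * vertex j) = (r : ℂ) * vertex i := by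
    intro i
    rw [sum_gauge_vertex hr, hS, Complex.ofReal_one, one_mul]
  refine ⟨isCentralConfiguration_of_sum_eq hα ha hcent hcc,
    fun v hv => hasDerivAt_action_centralConfiguration hα ha hcc p hv, ?_⟩
  ext u
  rw [SetLike.mem_coe, Submodule.mem_span_singleton, Set.mem_ofPred_eq]
  constructor
  · rintro ⟨hu, hker⟩
    refine exists_smul_eq_of_loopCoeff_eq_zero hr hu
      (fun m hm n hmn => loopCoeff_eq_zero hk hα hr hS hp hdet hdet0 hu hker hm hmn) ?_
    -- At `m = n = 0` both coefficients equal `(α + 1) / 2`, so the equation only kills the real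
    -- part, the homothety direction.
    have h := loopCoeff_equation hα hr hS hu hker (m := 0)
      (not_dvd_of_lt (by norm_num) (by omega)) 0
    rw [neg_zero, zero_add, hS, symbol_zero] at h
    have h2 := congrArg Complex.re h
    simp only [Int.cast_zero, zero_div, add_zero, one_pow, mul_one, sub_zero, Complex.add_re,
      Complex.re_ofReal_mul, Complex.conj_re, Complex.zero_re] at h2
    have h3 : (α + 1) * (loopCoeff 0 0 u).re = 0 := by linarith
    exact (mul_eq_zero.1 h3).resolve_left (by linarith)
  · rintro ⟨t, rfl⟩
    exact hessian_rotation_eq_zero hα ha hcent hcc p t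

theorem polygonNondegenerate_of_modeDet (hk : 3 ≤ k) (hα : 1 < α) {p : ℕ} (hp : p ≠ 0)
    (hdet : ∀ m : ℕ, 2 ≤ m → m + 2 ≤ k → ∀ n : ℤ,
      modeDet k α (sOne k α ^ (1 / (α + 1))) m (n / p) ≠ 0)
    (hdet0 : ∀ n : ℤ, ((n : ℝ) / p) ^ 2 ≠ 3 - α) : PolygonNondegenerate k α p := by
  have h := isNondegenerate_vertex (k := k) (p := (p : ℤ)) hk hα
    (Real.rpow_pos_of_pos (sOne_pos (by omega) α) _)
    (symbol_one_polygon (by omega) (by linarith)) (by exact_mod_cast hp)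
    (by simpa using hdet) (by simpa using hdet0)
  rw [PolygonNondegenerate, funext (polygon_eq (k := k) α)]
  exact h

end LoopModes

/-! ### The logarithmic limit `α → 1` -/

section LogLimit

variable {k : ℕ}

/-- The circumradius of `polygon k α`. -/
def radius (k : ℕ) (α : ℝ) : ℝ := sOne k α ^ (1 / (α + 1))

theorem radius_pos (hk : 2 ≤ k) (α : ℝ) : 0 < radius k α :=
  Real.rpow_pos_of_pos (sOne_pos hk α) _

theorem continuousAt_sOne (k : ℕ) (α : ℝ) : ContinuousAt (sOne k) α := by
  refine ContinuousAt.mul ?_ (tendsto_finsetSum _ fun l hl => ?_)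
  · exact continuousAt_const.div (continuousAt_const.rpow continuousAt_id (Or.inl two_ne_zero))
      (Real.rpow_pos_of_pos two_pos _).ne'
  · have hs := sin_pos_of_mem_Ico hl
    exact continuousAt_const.div (continuousAt_const.rpow (continuousAt_id.sub continuousAt_const)
      (Or.inl hs.ne')) (Real.rpow_pos_of_pos hs _).ne'

theorem continuousAt_radius (hk : 2 ≤ k) : ContinuousAt (radius k) 1 :=
  (continuousAt_sOne k 1).rpow (continuousAt_const.div (continuousAt_id.add continuousAt_const)
    (by norm_num)) (Or.inl (sOne_pos hk 1).ne')

theorem radius_one_sq (hk : 2 ≤ k) : radius k 1 ^ 2 = ((k : ℝ) - 1) / 2 := by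
  have hs : sOne k 1 = ((k : ℝ) - 1) / 2 := by
    have : ((k - 1 : ℕ) : ℝ) = (k : ℝ) - 1 := by rw [Nat.cast_sub (by omega), Nat.cast_one]
    simp [sOne, this]
    ring
  have h0 := sOne_pos hk 1
  rw [radius, ← Real.rpow_natCast, ← Real.rpow_mul h0.le, hs]
  norm_num

variable [NeZero k]

theorem continuousAt_symbol_radius (hk : 2 ≤ k) (m : ℤ) :
    ContinuousAt (fun α => symbol k α (radius k α) m) 1 := by
  refine tendsto_finsetSum _ fun l _ => ?_
  by_cases hl : l = 0
  · subst hl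
    simp [root_zero]
  · have h1 : 0 < ‖1 - root l‖ :=
      norm_pos_iff.2 (sub_ne_zero.2 fun h => hl (root_eq_one_iff.1 h.symm))
    exact ContinuousAt.mul (((continuousAt_radius hk).mul continuousAt_const).rpow
      (continuousAt_id.add continuousAt_const).neg
      (Or.inl (mul_pos (radius_pos hk 1) h1).ne')) continuousAt_const

theorem sum_root_zpow_re {m : ℤ} (hm : ¬ (k : ℤ) ∣ m) : ∑ l : Fin k, (root l ^ m).re = 0 := by
  have h : ∀ l : Fin k, vertex l ^ m = zeta k ^ m * root l ^ m := fun l => by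
    rw [vertex, root, pow_succ', mul_zpow]
  have h1 := sum_vertex_zpow_eq_zero hm
  simp only [h, ← Finset.mul_sum] at h1
  rw [← Complex.re_sum, (mul_eq_zero.1 h1).resolve_left (zpow_ne_zero _ zeta_ne_zero),
    Complex.zero_re]

/-- For `α = 1` and `l ≠ 0`, `g_l (1 - cos θ_l)` is the constant `1 / (2 r²)`. The second difference
of the symbol in `m` is therefore `r⁻²` times the sum of `cos (m θ_l)` over `l ≠ 0`, which is `-1`;
and `r² = (k - 1) / 2`. -/
theorem symbol_log_recurrence (hk : 2 ≤ k) {m : ℤ} (hm : ¬ (k : ℤ) ∣ m) :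
    symbol k 1 (radius k 1) (m + 1) =
      2 * symbol k 1 (radius k 1) m - symbol k 1 (radius k 1) (m - 1) - 2 / ((k : ℝ) - 1) := by
  have hterm : ∀ l : Fin k,
      gauge 1 (radius k 1) l * (1 - (root l ^ (m + 1)).re) +
        gauge 1 (radius k 1) l * (1 - (root l ^ (m - 1)).re) -
          2 * (gauge 1 (radius k 1) l * (1 - (root l ^ m).re)) =
      1 / radius k 1 ^ 2 * ((root l ^ m).re - if l = 0 then 1 else 0) := by
    intro l
    by_cases hl : l = 0
    · subst hl; simp [root_zero]
    have h1 : 0 < ‖1 - root l‖ :=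
      norm_pos_iff.2 (sub_ne_zero.2 fun h => hl (root_eq_one_iff.1 h.symm))
    have hr := radius_pos hk 1
    have hg : gauge 1 (radius k 1) l * (1 - (root l).re) = 1 / (2 * radius k 1 ^ 2) := by
      rw [gauge, one_sub_re_eq _ (norm_root l), show (-(1 + 1) : ℝ) = ((-2 : ℤ) : ℝ) by norm_num,
        Real.rpow_intCast, zpow_neg, zpow_ofNat]
      field_simp
    have hre : (root l ^ (m + 1)).re + (root l ^ (m - 1)).re =
        2 * (root l).re * (root l ^ m).re := by
      rw [zpow_add_one₀ (root_ne_zero l), zpow_sub_one₀ (root_ne_zero l),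
        ← conj_eq_inv_of_norm_eq_one (norm_root l)]
      simp only [Complex.mul_re, Complex.conj_re, Complex.conj_im]
      ring
    rw [if_neg hl, sub_zero]
    have h2 : (1 : ℝ) / radius k 1 ^ 2 = 2 * (1 / (2 * radius k 1 ^ 2)) := by field_simp
    rw [h2, ← hg]
    linear_combination -gauge 1 (radius k 1) l * hre
  have hsum := Finset.sum_congr (rfl : (Finset.univ : Finset (Fin k)) = Finset.univ)
    fun l _ => hterm l
  rw [Finset.sum_sub_distrib, Finset.sum_add_distrib, ← Finset.mul_sum, ← Finset.mul_sum,
    Finset.sum_sub_distrib, sum_root_zpow_re hm, radius_one_sq hk] at hsum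
  simp only [Finset.sum_ite_eq', Finset.mem_univ, if_true, one_div, inv_div] at hsum
  simp only [symbol]
  linarith

theorem symbol_log (hk : 2 ≤ k) {m : ℕ} (hm : m ≤ k) :
    symbol k 1 (radius k 1) m = m * ((k : ℝ) - m) / ((k : ℝ) - 1) := by
  have hk1 : ((k : ℝ) - 1) ≠ 0 := by
    have : (2 : ℝ) ≤ k := by exact_mod_cast hk
    linarith
  induction m using Nat.twoStepInduction with
  | zero => simp [symbol_zero]
  | one =>
    have : symbol k 1 (radius k 1) 1 = 1 := symbol_one_polygon hk one_pos
    rw [Nat.cast_one, this, Nat.cast_one, one_mul, div_self hk1]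
  | more m h1 h2 =>
    have h := symbol_log_recurrence hk (m := (m : ℤ) + 1)
      (not_dvd_of_lt (by omega) (by omega))
    have h2' := h2 (by omega)
    push_cast at h2' ⊢
    rw [add_sub_cancel_right, h1 (by omega), h2'] at h
    rw [show (m : ℤ) + 2 = m + 1 + 1 by ring, h]
    field_simp
    ring

end LogLimit

/-! ### Arithmetic of the limiting frequencies -/

/-- The `q`-adic valuation is odd on the left and even on the right. -/
theorem sq_mul_ne_sq_mul_of_not_dvd {q : ℕ} (hq : q.Prime) {n p X : ℤ} (hp : p ≠ 0)
    (hX : ¬ (q : ℤ) ∣ X) : n ^ 2 * q ≠ p ^ 2 * X := by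
  intro h
  have := Fact.mk hq
  have hX0 : X ≠ 0 := fun h0 => hX (h0 ▸ dvd_zero _)
  have hq0 : (q : ℤ) ≠ 0 := by exact_mod_cast hq.ne_zero
  have hn : n ≠ 0 := by
    rintro rfl
    rw [zero_pow two_ne_zero, zero_mul] at h
    exact (mul_ne_zero (pow_ne_zero 2 hp) hX0) h.symm
  have hv := congrArg (padicValInt q) h
  rw [padicValInt.mul (pow_ne_zero 2 hn) hq0, padicValInt.mul (pow_ne_zero 2 hp) hX0, pow_two,
    pow_two, padicValInt.mul hn hn, padicValInt.mul hp hp, padicValInt.self hq.one_lt,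
    padicValInt.eq_zero_of_not_dvd hX] at hv
  omega

/-- Both factors lie strictly between `0` and the prime `k - 1`. -/
theorem not_dvd_mul_sub {k m : ℕ} (hk : (k - 1).Prime) (h2 : 2 ≤ m) (hm : m + 2 ≤ k) :
    ¬ ((k - 1 : ℕ) : ℤ) ∣ (m : ℤ) * (k - m) := by
  rw [← Nat.cast_sub (by omega), ← Nat.cast_mul, Int.natCast_dvd_natCast, hk.dvd_mul]
  rintro (h | h)
  · exact absurd (Nat.le_of_dvd (by omega) h) (by omega)
  · exact absurd (Nat.le_of_dvd (by omega) h) (by omega)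

/-- The diagonal product is at least `(ν² - 1)² ≥ C²`, which exceeds the squared coupling. -/
theorem modeDet_pos {k : ℕ} {α r : ℝ} (hα : 1 ≤ α) (hr : 0 ≤ r) (m : ℤ) {ν C : ℝ}
    (hC : |(α + 1) / 2 * (1 - symbol k α r m)| < C) (hν : C + 1 ≤ ν ^ 2) :
    0 < modeDet k α r m ν := by
  have hβ : 0 ≤ (α - 1) / 2 := by linarith
  have h1 := mul_nonneg hβ (symbol_nonneg hr (k := k) (α := α) (m + 1))
  have h2 := mul_nonneg hβ (symbol_nonneg hr (k := k) (α := α) (m - 1))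
  have hC0 : 0 < C := (abs_nonneg _).trans_lt hC
  have h3 : ((α + 1) / 2 * (1 - symbol k α r m)) ^ 2 < C ^ 2 := by
    rw [← sq_abs]; gcongr
  have h4 : C ^ 2 ≤ (ν ^ 2 - 1) ^ 2 := by gcongr; linarith
  have h5 : (ν ^ 2 - 1) ^ 2 = (1 + ν) ^ 2 * (1 - ν) ^ 2 := by ring
  have h6 : (1 + ν) ^ 2 * (1 - ν) ^ 2 ≤ ((1 + ν) ^ 2 + (α - 1) / 2 * symbol k α r (m + 1)) *
      ((1 - ν) ^ 2 + (α - 1) / 2 * symbol k α r (m - 1)) := by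
    gcongr <;> linarith
  rw [modeDet]
  linarith

/-! ### Persistence of nonzero determinants for exponents near one -/

section Eventually

open Filter Topology

variable {k : ℕ} [NeZero k]

theorem modeDet_log_ne_zero (hk : (k - 1).Prime) {p : ℕ} (hp : p ≠ 0) {m : ℕ} (h2 : 2 ≤ m)
    (hm : m + 2 ≤ k) (n : ℤ) : modeDet k 1 (radius k 1) m (n / p) ≠ 0 := by
  have hS := symbol_log (k := k) (by omega) (show m ≤ k by omega)
  have hkq : (k : ℝ) - 1 = ((k - 1 : ℕ) : ℝ) := by
    rw [Nat.cast_sub (by omega), Nat.cast_one]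
  have hq0 : ((k - 1 : ℕ) : ℝ) ≠ 0 := by exact_mod_cast hk.ne_zero
  have hp0 : (p : ℝ) ≠ 0 := by exact_mod_cast hp
  have hpZ : (p : ℤ) ≠ 0 := by exact_mod_cast hp
  have hdvd := not_dvd_mul_sub hk h2 hm
  rw [modeDet, hS, hkq]
  intro h
  set q := k - 1 with hq
  -- At `α = 1` the determinant is `(1 - ν²)² - (1 - S)²`, a difference of squares.
  have hfac : ((n : ℝ) ^ 2 * q - p ^ 2 * (m * (k - m))) *
      ((n : ℝ) ^ 2 * q - p ^ 2 * (2 * q - m * (k - m))) = 0 := by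
    field_simp at h
    linear_combination h / 4
  rcases mul_eq_zero.1 hfac with h1 | h1
  · refine sq_mul_ne_sq_mul_of_not_dvd (n := n) hk hpZ hdvd ?_
    exact_mod_cast sub_eq_zero.1 h1
  · refine sq_mul_ne_sq_mul_of_not_dvd (n := n) (X := 2 * q - m * (k - m)) hk hpZ ?_ ?_
    · exact fun h3 => hdvd ((dvd_sub_right (Dvd.intro_left 2 rfl)).1 h3)
    · exact_mod_cast sub_eq_zero.1 h1

theorem continuousAt_modeDet (hk : 2 ≤ k) (m : ℤ) (ν : ℝ) :
    ContinuousAt (fun α => modeDet k α (radius k α) m ν) 1 := by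
  unfold modeDet
  have h := continuousAt_symbol_radius hk
  have h1 := h (m + 1)
  have h2 := h (m - 1)
  have h3 := h m
  fun_prop

theorem eventually_modeDet_ne_zero (hk : (k - 1).Prime) {p : ℕ} (hp : p ≠ 0) :
    ∀ᶠ α in 𝓝[>] (1 : ℝ), ∀ m : ℕ, 2 ≤ m → m + 2 ≤ k → ∀ n : ℤ,
      modeDet k α (radius k α) m (n / p) ≠ 0 := by
  have hk2 : 2 ≤ k := by have := hk.two_le; omega
  have key : ∀ m ∈ Finset.range k, ∀ᶠ α in 𝓝[>] (1 : ℝ), 2 ≤ m → m + 2 ≤ k → ∀ n : ℤ,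
      modeDet k α (radius k α) m (n / p) ≠ 0 := by
    intro m _
    by_cases hm : 2 ≤ m ∧ m + 2 ≤ k
    swap
    · exact Eventually.of_forall fun _ h2 h3 => absurd ⟨h2, h3⟩ hm
    have hcont : ContinuousAt
        (fun α => |(α + 1) / 2 * (1 - symbol k α (radius k α) m)|) 1 := by
      have := continuousAt_symbol_radius hk2 (m : ℤ)
      fun_prop
    -- A strict bound on the coupling at `α = 1` persists nearby; `N` is chosen so that `|n| > N`
    -- forces `ν² ≥ C + 1`, leaving finitely many `n`.
    obtain ⟨C, hC⟩ := exists_gt |((1 : ℝ) + 1) / 2 * (1 - symbol k 1 (radius k 1) m)|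
    obtain ⟨N, hN⟩ := exists_nat_ge ((C + 1) * (p : ℝ) ^ 2)
    have hfin : ∀ᶠ α in 𝓝[>] (1 : ℝ), ∀ n ∈ Finset.Icc (-(N : ℤ)) N,
        modeDet k α (radius k α) m (n / p) ≠ 0 := by
      rw [Filter.eventually_all_finset]
      exact fun n _ => nhdsWithin_le_nhds ((continuousAt_modeDet hk2 m (n / p)).eventually_ne
        (modeDet_log_ne_zero hk hp hm.1 hm.2 n))
    filter_upwards [hfin, nhdsWithin_le_nhds (hcont.eventually_lt_const hC),
      self_mem_nhdsWithin] with α h1 h2 h3 _ _ n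
    by_cases hn : n ∈ Finset.Icc (-(N : ℤ)) N
    · exact h1 n hn
    refine (modeDet_pos (le_of_lt h3) (radius_pos hk2 α).le m h2 ?_).ne'
    have hp0 : (0 : ℝ) < p := by exact_mod_cast Nat.pos_of_ne_zero hp
    rw [div_pow, le_div_iff₀ (by positivity)]
    refine hN.trans ?_
    have hn' : (N : ℤ) < |n| := by
      by_contra hcon
      exact hn (Finset.mem_Icc.2 (abs_le.1 (not_lt.1 hcon)))
    have hn2 : (N : ℤ) ≤ n ^ 2 := by
      rw [← sq_abs]
      nlinarith
    exact_mod_cast hn2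
  filter_upwards [(Filter.eventually_all_finset _).2 key] with α h m h2 hm
  exact h m (Finset.mem_range.2 (by omega)) h2 hm

theorem exists_delta_of_eventually {P : ℝ → Prop} (h : ∀ᶠ α in 𝓝[>] (1 : ℝ), P α) :
    ∃ δ : ℝ, 0 < δ ∧ ∀ α ∈ Set.Ioo (1 : ℝ) (1 + δ), P α := by
  obtain ⟨b, hb, hsub⟩ := mem_nhdsGT_iff_exists_Ioo_subset.1 h
  exact ⟨b - 1, sub_pos.2 hb, fun α hα => hsub ⟨hα.1, by linarith [hα.2]⟩⟩

end Eventually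

/-! ### Admissible periods -/

/-- Translates the excluded set into the zeros of the `m = 0` determinant; the sign of `n` is lost
in the square. -/
theorem eq_rpow_mul_natAbs_iff {α : ℝ} (hα : α < 3) {p : ℕ} (hp : p ≠ 0) :
    (∃ n : ℕ, (p : ℝ) = (3 - α) ^ (-(1 / 2) : ℝ) * n) ↔ ∃ n : ℤ, ((n : ℝ) / p) ^ 2 = 3 - α := by
  have h3 : 0 < 3 - α := by linarith
  have hp0 : (0 : ℝ) < p := by exact_mod_cast Nat.pos_of_ne_zero hp
  have hs := Real.sqrt_pos.2 h3
  rw [Real.rpow_neg h3.le, ← Real.sqrt_eq_rpow]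
  constructor
  · rintro ⟨n, hn⟩
    refine ⟨n, ?_⟩
    have : (n : ℝ) = p * √(3 - α) := by rw [hn]; field_simp
    rw [Int.cast_natCast, this, mul_div_cancel_left₀ _ hp0.ne', Real.sq_sqrt h3.le]
  · rintro ⟨n, hn⟩
    refine ⟨n.natAbs, ?_⟩
    rw [← hn, Real.sqrt_sq_eq_abs, abs_div, abs_of_pos hp0, Nat.cast_natAbs, Int.cast_abs]
    have hn0 : |(n : ℝ)| ≠ 0 := by
      intro h0
      rw [abs_eq_zero.1 h0] at hn
      norm_num at hn
      linarith
    field_simp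

theorem exists_common_denominator {B : Set ℝ} (hB : B.Finite) :
    ∃ N : ℕ, N ≠ 0 ∧ ∀ x ∈ B, (∃ q : ℚ, (q : ℝ) = x) → ∃ z : ℤ, N * x = z := by
  induction B, hB using Set.Finite.induction_on with
  | empty => exact ⟨1, one_ne_zero, fun x hx => absurd hx (Set.notMem_empty x)⟩
  | @insert y S _ _ ih =>
    obtain ⟨N, hN, h⟩ := ih
    by_cases hy : ∃ q : ℚ, (q : ℝ) = y
    · obtain ⟨q, rfl⟩ := hy
      refine ⟨N * q.den, mul_ne_zero hN q.den_nz, fun x hx hxq => ?_⟩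
      rcases hx with rfl | hx
      · refine ⟨N * q.num, ?_⟩
        have : (q.den : ℝ) * q = q.num := by exact_mod_cast Rat.den_mul_eq_num q
        push_cast
        rw [mul_assoc, this]
      · obtain ⟨z, hz⟩ := h x hx hxq
        exact ⟨q.den * z, by push_cast; rw [← hz]; ring⟩
    · refine ⟨N, hN, fun x hx hxq => ?_⟩
      rcases hx with rfl | hx
      · exact absurd hxq hy
      · exact h x hx hxq

theorem exists_avoiding_progression {B : Set ℝ} (hB : B.Finite) (hZ : ∀ z : ℤ, (z : ℝ) ∉ B)
    (q : ℕ) : ∃ N : ℕ, N ≠ 0 ∧ ∀ t : ℕ, ∀ n : ℤ, (n : ℝ) / (1 + q * N * t : ℕ) ∉ B := by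
  obtain ⟨N, hN, h⟩ := exists_common_denominator hB
  refine ⟨N, hN, fun t n hx => ?_⟩
  have hp0 : ((1 + q * N * t : ℕ) : ℝ) ≠ 0 := by positivity
  obtain ⟨z, hz⟩ := h _ hx ⟨(n : ℚ) / (1 + q * N * t : ℕ), by push_cast; ring⟩
  -- If `x = n / p` and `N x = z`, then `n = x (1 + q N t) = x + q t z`, so `x` would be an integer.
  refine hZ (n - q * t * z) ?_
  convert hx using 1
  generalize hxx : (n : ℝ) / (1 + q * N * t : ℕ) = x at hz
  have hn : (n : ℝ) = x * (1 + q * N * t : ℕ) := (div_eq_iff hp0).1 hxx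
  push_cast at hn ⊢
  rw [hn, ← hz]
  ring

/-- The determinant is a polynomial in `ν`, nonzero since its value at `0` is. -/
theorem finite_setOf_modeDet_eq_zero {k : ℕ} {α r : ℝ} {m : ℤ}
    (h0 : modeDet k α r m 0 ≠ 0) : {ν | modeDet k α r m ν = 0}.Finite := by
  let P : Polynomial ℝ :=
    ((1 + Polynomial.X) ^ 2 + Polynomial.C ((α - 1) / 2 * symbol k α r (m + 1))) *
      ((1 - Polynomial.X) ^ 2 + Polynomial.C ((α - 1) / 2 * symbol k α r (m - 1))) -
      Polynomial.C (((α + 1) / 2 * (1 - symbol k α r m)) ^ 2)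
  have hP : ∀ ν, P.eval ν = modeDet k α r m ν := fun ν => by
    simp only [P, modeDet, Polynomial.eval_sub, Polynomial.eval_mul, Polynomial.eval_add,
      Polynomial.eval_pow, Polynomial.eval_C, Polynomial.eval_X, Polynomial.eval_one]
  have hne : P ≠ 0 := fun h => h0 (by rw [← hP, h, Polynomial.eval_zero])
  refine (Polynomial.finite_setOfPred_isRoot hne).subset fun ν hν => ?_
  exact (hP ν).trans hν

theorem finite_setOf_sq_eq (c : ℝ) : {ν : ℝ | ν ^ 2 = c}.Finite := by
  refine (Set.toFinite {√c, -√c}).subset fun ν hν => ?_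
  have hν' : ν ^ 2 = c := hν
  rw [← hν', Real.sqrt_sq_eq_abs]
  rcases abs_choice ν with h | h <;> simp [h]

/-- No integer square lies strictly between `1` and `2`. -/
theorem three_sub_ne_int_sq {α : ℝ} (h1 : 1 < α) (h2 : α < 2) (z : ℤ) : (z : ℝ) ^ 2 ≠ 3 - α := by
  intro h
  have h3 : (1 : ℝ) < (z : ℝ) ^ 2 := by linarith
  have h4 : (z : ℝ) ^ 2 < 2 := by linarith
  have h3' : (1 : ℤ) < z ^ 2 := by exact_mod_cast h3
  have h4' : z ^ 2 < (2 : ℤ) := by exact_mod_cast h4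
  omega

end Carousel

end

/-! ### Perturbation for a fixed period, and a progression of good periods -/

open Carousel

theorem mainTheorem3 (k : ℕ) (hk : (k - 1).Prime) :
    (∀ p : ℕ, ∃ δ : ℝ, 0 < δ ∧ ∀ α ∈ Set.Ioo (1 : ℝ) (1 + δ),
      p ∈ Carousel.admissible k α → Carousel.PolygonNondegenerate k α p) ∧
    (∃ δ : ℝ, 0 < δ ∧ ∀ α ∈ Set.Ioo (1 : ℝ) (1 + δ),
      (Carousel.admissible k α).Infinite ∧
      {p ∈ Carousel.admissible k α | Carousel.PolygonNondegenerate k α p}.Infinite) := by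
  have hk3 : 3 ≤ k := by have := hk.two_le; omega
  have : NeZero k := ⟨by omega⟩
  have hlt2 : ∀ᶠ α in nhdsWithin (1 : ℝ) (Set.Ioi 1), α < 2 :=
    nhdsWithin_le_nhds (Iio_mem_nhds one_lt_two)
  constructor
  · intro p
    rcases eq_or_ne p 0 with rfl | hp
    · exact ⟨1, one_pos, fun α _ hadm => absurd ⟨0, (mul_zero _).symm⟩ hadm.1⟩
    obtain ⟨δ, hδ, h⟩ := exists_delta_of_eventually
      ((eventually_modeDet_ne_zero hk hp).and hlt2)
    refine ⟨δ, hδ, fun α hα hadm => ?_⟩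
    obtain ⟨hdet, hα2⟩ := h α hα
    refine polygonNondegenerate_of_modeDet hk3 hα.1 hp hdet fun n hn => ?_
    exact hadm.2 ((eq_rpow_mul_natAbs_iff (by linarith) hp).2 ⟨n, hn⟩)
  -- Period `p = 1` makes `ν` range over all integers, so this `δ` depends on `k` alone.
  · obtain ⟨δ, hδ, h⟩ := exists_delta_of_eventually
      ((eventually_modeDet_ne_zero hk one_ne_zero).and hlt2)
    refine ⟨δ, hδ, fun α hα => ?_⟩
    obtain ⟨hdet, hα2⟩ := h α hα
    simp only [Nat.cast_one, div_one] at hdet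
    set B : Set ℝ := (⋃ m ∈ {m ∈ Finset.range k | 2 ≤ m ∧ m + 2 ≤ k},
      {ν | modeDet k α (radius k α) (m : ℕ) ν = 0}) ∪ {ν | ν ^ 2 = 3 - α} with hBdef
    have hB : B.Finite := by
      refine Set.Finite.union (Set.Finite.biUnion (Finset.finite_toSet _) fun m hm => ?_)
        (finite_setOf_sq_eq _)
      have hm' := (Finset.mem_filter.1 hm).2
      exact finite_setOf_modeDet_eq_zero (by simpa using hdet m hm'.1 hm'.2 0)
    have hZ : ∀ z : ℤ, (z : ℝ) ∉ B := by
      rintro z (hz | hz)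
      · obtain ⟨m, hm, hz⟩ := Set.mem_iUnion₂.1 hz
        have hm' := (Finset.mem_filter.1 hm).2
        exact hdet m hm'.1 hm'.2 z hz
      · exact three_sub_ne_int_sq hα.1 hα2 z hz
    -- The step of the progression is a multiple of `k - 1`, so its members are `1` modulo `k - 1`
    -- and are not multiples of it.
    obtain ⟨N, hN, havoid⟩ := exists_avoiding_progression hB hZ (k - 1)
    have hmem : ∀ t : ℕ, 1 + (k - 1) * N * t ∈
        {p ∈ Carousel.admissible k α | Carousel.PolygonNondegenerate k α p} := by
      intro t
      have hp : 1 + (k - 1) * N * t ≠ 0 := by omega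
      have hsq : ∀ n : ℤ, ((n : ℝ) / (1 + (k - 1) * N * t : ℕ)) ^ 2 ≠ 3 - α :=
        fun n hn => havoid t n (Or.inr hn)
      refine ⟨⟨?_, ?_⟩, ?_⟩
      · rintro ⟨n, hn⟩
        have h1 : (k - 1) ∣ 1 := by
          refine (Nat.dvd_add_left (show k - 1 ∣ (k - 1) * N * t from ?_)).1 ⟨n, hn⟩
          exact Dvd.intro _ (mul_assoc _ _ _).symm
        exact hk.one_lt.ne' (Nat.dvd_one.1 h1)
      · rw [eq_rpow_mul_natAbs_iff (by linarith) hp]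
        rintro ⟨n, hn⟩
        exact hsq n hn
      · refine polygonNondegenerate_of_modeDet hk3 hα.1 hp (fun m h2 hm n h0 => ?_) hsq
        refine havoid t n (Or.inl (Set.mem_iUnion₂.2 ⟨m, ?_, h0⟩))
        exact Finset.mem_filter.2 ⟨Finset.mem_range.2 (by omega), h2, hm⟩
    have hinj : Function.Injective fun t : ℕ => 1 + (k - 1) * N * t := by
      intro s t hst
      have h0 : 0 < (k - 1) * N := Nat.mul_pos hk.pos (Nat.pos_of_ne_zero hN)
      exact Nat.eq_of_mul_eq_mul_left h0 (Nat.add_left_cancel hst)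
    have hinf := Set.infinite_of_injective_forall_mem hinj hmem
    exact ⟨hinf.mono fun p hp => hp.1, hinf⟩
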